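/- All Hilbert spaces are finite dimensional and $\log$ is to base $2$, with $\log 0=-\infty$. A state (substate) is a positive semidefinite operator with trace $1$ (at most $1$); $\mathcal S(\mathcal H)$ is the set of states on $\mathcal H$. For a substate $\rho$ and $\sigma\ge 0$ let $D(\rho\|\sigma)=\operatorname{tr}(\rho\log\rho-\rho\log\sigma)$ if $\operatorname{supp}\rho\le\operatorname{supp}\sigma$ and $+\infty$ otherwise, $D_{\max}(\rho\|\sigma)=\inf\{\log\lambda:\lambda>0,\ \rho\le\lambda\sigma\}$, $D_{\min}(\rho\|\sigma)=-2\log\operatorname{tr}|\rho^{1/2}\sigma^{1/2}|$, and for $\alpha\in[1/2,1)\cup(1,\infty)$ $$D_\alpha(\rho\|\sigma)=\frac1{\alpha-1}\log\operatorname{tr}\Big[\big(\sigma^{\frac{1-\alpha}{2\alpha}}\rho\,\sigma^{\frac{1-\alpha}{2\alpha}}\big)^\alpha\Big]$$ (negative powers on the support; $+\infty$ if $\alpha>1$ and $\operatorname{supp}\rho\not\le\operatorname{supp}\sigma$); $D_1=D$ and $D_\infty=D_{\max}$. For substates put $F(\rho,\sigma)=\operatorname{tr}|\sqrt\rho\sqrt\sigma|+\sqrt{(1-\operatorname{tr}\rho)(1-\operatorname{tr}\sigma)}$,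 and write $\rho'\sim^\varepsilon\rho$ if $\rho'$ is a substate with $\sqrt{1-F(\rho',\rho)^2}\le\varepsilon$. Let $D^\varepsilon_{\max}(\rho\|\sigma)=\inf_{\rho'\sim^\varepsilon\rho}D_{\max}(\rho'\|\sigma)$ and $D^\varepsilon_{\min}(\rho\|\sigma)=\sup_{\rho'\sim^\varepsilon\rho}D_{\min}(\rho'\|\sigma)$. For a unital $*$-subalgebra $\mathcal N\subseteq B(\mathcal H_A)$ and $\mathbb D\in\{D_{\max},D_{\min},D_\alpha\}$ let $\mathbb D(\rho\|\mathcal N)=\inf_{\sigma\in\mathcal N\cap\mathcal S(\mathcal H_A)}\mathbb D(\rho\|\sigma)$, $D^\varepsilon_{\max}(\rho\|\mathcal N)=\inf_{\rho'\sim^\varepsilon\rho}D_{\max}(\rho'\|\mathcal N)$ and $D^\varepsilon_{\min}(\rho\|\mathcal N)=\sup_{\rho'\sim^\varepsilon\rho}D_{\min}(\rho'\|\mathcal N)$. For a substate $\tau$ on $\mathcal H_E\otimes\mathcal H_A$ let $H_{\min}(E|A)_\tau=-\inf_{\sigma\in\mathcal S(\mathcal H_A)}D_{\max}(\tau\|1_E\otimes\sigma)$,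 $H_{\max}(E|A)_\tau=-\inf_{\sigma\in\mathcal S(\mathcal H_A)}D_{\min}(\tau\|1_E\otimes\sigma)$, $H^\varepsilon_{\min}(E|A)_\tau=\sup_{\tau'\sim^\varepsilon\tau}H_{\min}(E|A)_{\tau'}$, $H^\varepsilon_{\max}(E|A)_\tau=\inf_{\tau'\sim^\varepsilon\tau}H_{\max}(E|A)_{\tau'}$. For $\alpha\ne1$ let $H_\alpha(E|A)_\tau=\sup_{\sigma\in\mathcal S(\mathcal H_A)}-D_\alpha(\tau\|1_E\otimes\sigma)$, and let $H_1(E|A)_\tau=H(E|A)_\tau=-\operatorname{tr}(\tau\log\tau)+\operatorname{tr}(\tau_A\log\tau_A)$ with $\tau_A=\operatorname{tr}_E\tau$. **Theorem.** Let $\mathcal N\subseteq B(\mathcal H_A)$ be a unital $*$-subalgebra, let $\mathcal E:B(\mathcal H_A)\to\mathcal N$ be its trace-preserving conditional expectation (the unique map into $\mathcal N$ with $\operatorname{tr}(x\,\mathcal E(y))=\operatorname{tr}(xy)$ for all $x\in\mathcal N$, $y\in B(\mathcal H_A)$), and let $V:\mathcal H_A\to\mathcal H_E\otimes\mathcal H_A$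 be an isometry with $\mathcal E(x)=\operatorname{tr}_E(VxV^*)$ for all $x$. Let $\rho$ be a state on $\mathcal H_A$. Then: (i) for every $\varepsilon\in[0,1)$, $$D^\varepsilon_{\max}(\rho\|\mathcal N)=\inf_{\sigma\in\mathcal S(\mathcal H_A)}D^\varepsilon_{\max}(V\rho V^*\|1_E\otimes\sigma)=-H^\varepsilon_{\min}(E|A)_{V\rho V^*},$$ $$D^\varepsilon_{\min}(\rho\|\mathcal N)=\inf_{\sigma\in\mathcal S(\mathcal H_A)}D^\varepsilon_{\min}(V\rho V^*\|1_E\otimes\sigma)=-H^\varepsilon_{\max}(E|A)_{V\rho V^*};$$ (ii) for every $\alpha\in[1/2,\infty]$, $$D_\alpha(\rho\|\mathcal N)=\inf_{\sigma\in\mathcal S(\mathcal H_A)}D_\alpha(V\rho V^*\|1_E\otimes\sigma)=-H_\alpha(E|A)_{V\rho V^*},$$ and the values at $\alpha=1$ are limits: $\lim_{\alpha\to1}D_\alpha(\rho\|\mathcal N)=D(\rho\|\mathcal N)$ and $\lim_{\alpha\to1}H_\alpha(E|A)_{V\rho V^*}=H(E|A)_{V\rho V^*}$. -/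

import Mathlib

open scoped Matrix Kronecker Topology ENNReal ComplexOrder

noncomputable section

namespace SubalgEntropy

variable {n A E : Type*} [Fintype n] [DecidableEq n] [Fintype A] [DecidableEq A]
  [Fintype E] [DecidableEq E]

/-- Density operators. -/
def IsState (ρ : Matrix n n ℂ) : Prop := ρ.PosSemidef ∧ ρ.trace = 1

/-- Subnormalised density operators. -/
def IsSubstate (ρ : Matrix n n ℂ) : Prop := ρ.PosSemidef ∧ ρ.trace.re ≤ 1

/-- The real part of the trace (all traces below are traces of operators with real trace). -/
def rtr (X : Matrix n n ℂ) : ℝ := X.trace.re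

/-- The power `X ^ p` of a positive semidefinite matrix, by the functional calculus. As
`0 ^ p = 0` in `ℝ` for every `p ≠ 0`, negative powers are taken on the support. -/
def matPow (X : Matrix n n ℂ) (p : ℝ) : Matrix n n ℂ := cfc (fun x : ℝ => x ^ p) X

/-- The base-2 logarithm of a positive semidefinite matrix, taken on its support (`logb 2 0 = 0`). -/
def matLog (X : Matrix n n ℂ) : Matrix n n ℂ := cfc (fun x : ℝ => Real.logb 2 x) X

/-- The trace norm `tr |X|`, where `|X| = (X* X)^{1/2}`. -/
def trNorm (X : Matrix n n ℂ) : ℝ := rtr (matPow (Xᴴ * X) (1 / 2))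

/-- The base-2 logarithm on `[0, ∞)` with values in the extended reals, `log 0 = -∞`. -/
def elog (x : ℝ) : EReal := if x ≤ 0 then ⊥ else ((Real.logb 2 x : ℝ) : EReal)

/-- `supp ρ ≤ supp σ`; the support projection of a Hermitian matrix projects onto its range. -/
def SuppLE (ρ σ : Matrix n n ℂ) : Prop :=
  LinearMap.range ρ.mulVecLin ≤ LinearMap.range σ.mulVecLin

/-- Generalised fidelity of two substates. -/
def fidelity (ρ σ : Matrix n n ℂ) : ℝ :=
  trNorm (matPow ρ (1 / 2) * matPow σ (1 / 2)) + √((1 - rtr ρ) * (1 - rtr σ))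

/-- Purified distance of two substates. -/
def purifiedDist (ρ σ : Matrix n n ℂ) : ℝ := √(1 - fidelity ρ σ ^ 2)

/-- The set of substates that are `ε`-close to `ρ` in purified distance. -/
def epsBall (ε : ℝ) (ρ : Matrix n n ℂ) : Set (Matrix n n ℂ) :=
  {ρ' | IsSubstate ρ' ∧ purifiedDist ρ' ρ ≤ ε}

/-! ### Relative entropies -/

open Classical in
/-- Relative entropy `D(ρ‖σ)`. -/
def relEnt (ρ σ : Matrix n n ℂ) : EReal :=
  if SuppLE ρ σ then ((rtr (ρ * matLog ρ - ρ * matLog σ) : ℝ) : EReal) else ⊤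

/-- Max relative entropy: the infimum of `log λ` over `λ > 0` with `ρ ≤ λ σ` (`+∞` if there is
no such `λ`). -/
def dMax (ρ σ : Matrix n n ℂ) : EReal :=
  ⨅ l ∈ {l : ℝ | 0 < l ∧ ((l : ℂ) • σ - ρ).PosSemidef}, elog l

/-- Min relative entropy `-2 log tr |ρ^{1/2} σ^{1/2}|`. -/
def dMin (ρ σ : Matrix n n ℂ) : EReal :=
  ((-2 : ℝ) : EReal) * elog (trNorm (matPow ρ (1 / 2) * matPow σ (1 / 2)))

/-- The trace functional `tr [(σ^{(1-α)/2α} ρ σ^{(1-α)/2α})^α]`. -/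
def sandwichTr (α : ℝ) (ρ σ : Matrix n n ℂ) : ℝ :=
  rtr (matPow (matPow σ ((1 - α) / (2 * α)) * ρ * matPow σ ((1 - α) / (2 * α))) α)

open Classical in
/-- Sandwiched Rényi relative entropy `D_α(ρ‖σ)`; it is `D_max` at `α = ∞`, the relative entropy at
`α = 1`, and `+∞` if `α > 1` and `supp ρ ≤ supp σ` fails. -/
def dAlpha (α : ℝ≥0∞) (ρ σ : Matrix n n ℂ) : EReal :=
  if α = ⊤ then dMax ρ σ
  else if α = 1 then relEnt ρ σ
  else if 1 < α ∧ ¬ SuppLE ρ σ then ⊤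
  else ((1 / (α.toReal - 1) : ℝ) : EReal) * elog (sandwichTr α.toReal ρ σ)

/-- Smooth max-relative entropy. -/
def dMaxSmooth (ε : ℝ) (ρ σ : Matrix n n ℂ) : EReal := ⨅ ρ' ∈ epsBall ε ρ, dMax ρ' σ

/-- Smooth min-relative entropy. -/
def dMinSmooth (ε : ℝ) (ρ σ : Matrix n n ℂ) : EReal := ⨆ ρ' ∈ epsBall ε ρ, dMin ρ' σ

/-! ### Subalgebra entropies -/

/-- The state space of a unital `*`-subalgebra. -/
def stateSpace (N : StarSubalgebra ℂ (Matrix n n ℂ)) : Set (Matrix n n ℂ) :=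
  {σ | σ ∈ N ∧ IsState σ}

/-- `D_max(ρ‖N)`. -/
def dMaxAlg (ρ : Matrix n n ℂ) (N : StarSubalgebra ℂ (Matrix n n ℂ)) : EReal :=
  ⨅ σ ∈ stateSpace N, dMax ρ σ

/-- `D_min(ρ‖N)`. -/
def dMinAlg (ρ : Matrix n n ℂ) (N : StarSubalgebra ℂ (Matrix n n ℂ)) : EReal :=
  ⨅ σ ∈ stateSpace N, dMin ρ σ

/-- `D_α(ρ‖N)`. -/
def dAlphaAlg (α : ℝ≥0∞) (ρ : Matrix n n ℂ) (N : StarSubalgebra ℂ (Matrix n n ℂ)) : EReal :=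
  ⨅ σ ∈ stateSpace N, dAlpha α ρ σ

/-- `D_max^ε(ρ‖N)`. -/
def dMaxAlgSmooth (ε : ℝ) (ρ : Matrix n n ℂ) (N : StarSubalgebra ℂ (Matrix n n ℂ)) : EReal :=
  ⨅ ρ' ∈ epsBall ε ρ, dMaxAlg ρ' N

/-- `D_min^ε(ρ‖N)`. -/
def dMinAlgSmooth (ε : ℝ) (ρ : Matrix n n ℂ) (N : StarSubalgebra ℂ (Matrix n n ℂ)) : EReal :=
  ⨆ ρ' ∈ epsBall ε ρ, dMinAlg ρ' N

/-! ### Conditional entropies `H(E|A)` of operators on `ℂ^E ⊗ ℂ^A` -/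

/-- The partial trace over the first tensor factor. -/
def ptraceE (X : Matrix (E × A) (E × A) ℂ) : Matrix A A ℂ :=
  Matrix.of fun i j => ∑ k : E, X (k, i) (k, j)

/-- The operator `1_E ⊗ σ`. -/
def oneTensor (E : Type*) [Fintype E] [DecidableEq E] (σ : Matrix A A ℂ) :
    Matrix (E × A) (E × A) ℂ := (1 : Matrix E E ℂ) ⊗ₖ σ

/-- The min-conditional entropy. -/
def hMin (τ : Matrix (E × A) (E × A) ℂ) : EReal :=
  -⨅ σ ∈ {σ : Matrix A A ℂ | IsState σ}, dMax τ (oneTensor E σ)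

/-- The max-conditional entropy. -/
def hMax (τ : Matrix (E × A) (E × A) ℂ) : EReal :=
  -⨅ σ ∈ {σ : Matrix A A ℂ | IsState σ}, dMin τ (oneTensor E σ)

/-- The smooth min-conditional entropy. -/
def hMinSmooth (ε : ℝ) (τ : Matrix (E × A) (E × A) ℂ) : EReal := ⨆ τ' ∈ epsBall ε τ, hMin τ'

/-- The smooth max-conditional entropy. -/
def hMaxSmooth (ε : ℝ) (τ : Matrix (E × A) (E × A) ℂ) : EReal := ⨅ τ' ∈ epsBall ε τ, hMax τ'

/-- The von Neumann entropy `-tr (ρ log ρ)`. -/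
def vnEntropy (ρ : Matrix n n ℂ) : ℝ := -rtr (ρ * matLog ρ)

/-- The von Neumann conditional entropy `H(E|A) = H(EA) - H(A)`. -/
def condEntropy (τ : Matrix (E × A) (E × A) ℂ) : ℝ := vnEntropy τ - vnEntropy (ptraceE τ)

open Classical in
/-- The sandwiched Rényi conditional entropy; at `α = 1` it is the von Neumann one. -/
def hAlpha (α : ℝ≥0∞) (τ : Matrix (E × A) (E × A) ℂ) : EReal :=
  if α = 1 then ((condEntropy τ : ℝ) : EReal)
  else ⨆ σ ∈ {σ : Matrix A A ℂ | IsState σ}, -dAlpha α τ (oneTensor E σ)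

/-! ### The trace-preserving conditional expectation and its Stinespring isometries -/

/-- The functional `y ↦ tr (y x)` on a subalgebra `N`. -/
def traceFunctional (N : StarSubalgebra ℂ (Matrix n n ℂ)) :
    Matrix n n ℂ →ₗ[ℂ] Module.Dual ℂ N where
  toFun x :=
    { toFun := fun y => ((y : Matrix n n ℂ) * x).trace
      map_add' := by intro a b; simp [add_mul]
      map_smul' := by intro c a; simp }
  map_add' := by intro a b; ext y; simp [mul_add]
  map_smul' := by intro c a; ext y; simp

theorem traceFunctional_injective (N : StarSubalgebra ℂ (Matrix n n ℂ)) :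
    Function.Injective ((traceFunctional N).comp N.toSubalgebra.toSubmodule.subtype) := by
  rw [← LinearMap.ker_eq_bot, LinearMap.ker_eq_bot']
  intro x hx
  have h := LinearMap.congr_fun hx (star x)
  have h2 : ((x : Matrix n n ℂ)ᴴ * (x : Matrix n n ℂ)).trace = 0 := h
  exact Subtype.ext (Matrix.trace_conjTranspose_mul_self_eq_zero_iff.mp h2)

/-- The trace pairing identifies `N` with its dual. -/
def traceEquiv (N : StarSubalgebra ℂ (Matrix n n ℂ)) : N ≃ₗ[ℂ] Module.Dual ℂ N :=
  haveI : FiniteDimensional ℂ N :=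
    inferInstanceAs (FiniteDimensional ℂ N.toSubalgebra.toSubmodule)
  LinearEquiv.ofInjectiveOfFinrankEq
    ((traceFunctional N).comp N.toSubalgebra.toSubmodule.subtype)
    (traceFunctional_injective N) (Subspace.dual_finrank_eq).symm

/-- The trace-preserving conditional expectation onto `N`: `condExp N y` is the unique element of
`N` with `tr (x * condExp N y) = tr (x * y)` for all `x ∈ N`. -/
def condExp (N : StarSubalgebra ℂ (Matrix n n ℂ)) : Matrix n n ℂ →ₗ[ℂ] Matrix n n ℂ :=
  N.toSubalgebra.toSubmodule.subtype ∘ₗ (traceEquiv N).symm.toLinearMap ∘ₗ traceFunctional N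

theorem condExp_mem (N : StarSubalgebra ℂ (Matrix n n ℂ)) (y : Matrix n n ℂ) :
    condExp N y ∈ N := ((traceEquiv N).symm (traceFunctional N y)).2

theorem trace_mul_condExp (N : StarSubalgebra ℂ (Matrix n n ℂ)) {x : Matrix n n ℂ} (hx : x ∈ N)
    (y : Matrix n n ℂ) : (x * condExp N y).trace = (x * y).trace :=
  LinearMap.congr_fun ((traceEquiv N).apply_symm_apply (traceFunctional N y)) ⟨x, hx⟩

/-- `V : ℂ^A → ℂ^E ⊗ ℂ^A` is a Stinespring isometry of the map `Φ`. -/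
def IsStinespringIsometry (Φ : Matrix A A ℂ →ₗ[ℂ] Matrix A A ℂ) (V : Matrix (E × A) A ℂ) : Prop :=
  Vᴴ * V = 1 ∧ ∀ x : Matrix A A ℂ, Φ x = ptraceE (V * x * Vᴴ)

end SubalgEntropy

end

set_option linter.unusedSectionVars false

/-! Two identities for V drive the proof. The expectation E is self-adjoint for the trace pairing,
so it coincides with its dual map: V*(1 ⊗ y)V = E(y) for all y (`compress_oneTensor`). And since E
fixes N, every x ∈ N satisfies (1 ⊗ x)V = Vx (`oneTensor_mul_isometry`).

For σ ∈ N, functional calculus therefore passes through V, and each divergence of VρV* from 1 ⊗ σ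
equals that of ρ from σ (`dAlpha_isometry`). For an arbitrary state σ, compression by V replaces 1 ⊗
σ by E(σ) ∈ N without increasing the divergence (`dAlpha_compress_le`). For finite α ≠ 1 this is an
operator Jensen inequality for the exponent (1 - α)/α, which lies in (-1, 1] because α ≥ 1/2. At α =
1, Gibbs' inequality shows that both infima are attained at tr_E(VρV*) = E(ρ).

Smoothing is compatible with both moves: ρ' ↦ Vρ'V* and τ ↦ V*τV map balls into balls. For D_max
this suffices, since infima commute. For D_min it gives D_min^ε(ρ‖N) ≤ -H_max^ε ≤ inf_σ D_min^ε, and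
the return to D_min^ε(ρ‖N) needs a minimax theorem. The fidelity is not convex in the smoothed
state, but for ρ' = XX* it equals tr|√σ X|, which is convex in X and concave in σ. Restricting to
amplitudes X with Re tr(√ρ X) ≥ √(1 - ε²) gives a compact convex set that loses nothing, and Sion's
theorem provides a saddle point (`exists_fidelity_saddle`).

For the limits at α = 1, put τ = VρV*. The sandwiched trace is bounded on one side uniformly in σ,
and on the other at σ = τ_A, by explicit functions of α. They all take the value 1 at α = 1 and have
derivative -(ln 2) H(E|A) there, so the optimised divergence is squeezed to -H(E|A)
(`tendsto_iInf_dAlpha`). -/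

namespace SubalgEntropy

/-! ### Functional calculus and traces of Hermitian matrices. -/

section FunctionalCalculus

open scoped MatrixOrder Matrix.Norms.L2Operator

variable {m n : Type*} [Fintype m] [DecidableEq m] [Fintype n] [DecidableEq n]

/-- The spectrum is finite, so every real function is admissible in the functional calculus,
including indicators of {0} and negative powers. -/
theorem continuousOn_spectrum (f : ℝ → ℝ) (X : Matrix n n ℂ) : ContinuousOn f (spectrum ℝ X) :=
  Matrix.finite_real_spectrum.continuousOn f

theorem cfc_mul_cfc (f g : ℝ → ℝ) (X : Matrix n n ℂ) :
    cfc f X * cfc g X = cfc (fun x => f x * g x) X :=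
  (cfc_mul f g X (continuousOn_spectrum _ _) (continuousOn_spectrum _ _)).symm

theorem cfc_add_cfc (f g : ℝ → ℝ) (X : Matrix n n ℂ) :
    cfc f X + cfc g X = cfc (fun x => f x + g x) X :=
  (cfc_add X f g (continuousOn_spectrum _ _) (continuousOn_spectrum _ _)).symm

theorem cfc_sub_cfc (f g : ℝ → ℝ) (X : Matrix n n ℂ) :
    cfc f X - cfc g X = cfc (fun x => f x - g x) X :=
  (cfc_sub f g X (continuousOn_spectrum _ _) (continuousOn_spectrum _ _)).symm

theorem cfc_cfc (f g : ℝ → ℝ) {X : Matrix n n ℂ} (hX : X.IsHermitian) :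
    cfc g (cfc f X) = cfc (fun x => g (f x)) X :=
  (cfc_comp' g f X (hg := (Matrix.finite_real_spectrum.image f).continuousOn g)
    (hf := continuousOn_spectrum _ _) (ha := hX)).symm

theorem cfc_self {X : Matrix n n ℂ} (hX : X.IsHermitian) : cfc (fun x : ℝ => x) X = X :=
  cfc_id' ℝ X hX.isSelfAdjoint

theorem cfc_const_eq {X : Matrix n n ℂ} (hX : X.IsHermitian) (c : ℝ) :
    cfc (fun _ : ℝ => c) X = c • 1 := by
  rw [cfc_const c X hX.isSelfAdjoint, Algebra.algebraMap_eq_smul_one]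

theorem isHermitian_cfc (f : ℝ → ℝ) (X : Matrix n n ℂ) : (cfc f X).IsHermitian :=
  cfc_predicate f X

theorem spectrum_nonneg {X : Matrix n n ℂ} (hX : X.PosSemidef) {x : ℝ} (hx : x ∈ spectrum ℝ X) :
    0 ≤ x := spectrum_nonneg_of_nonneg hX.nonneg hx

theorem cfc_congr_nonneg {X : Matrix n n ℂ} (hX : X.PosSemidef) {f g : ℝ → ℝ}
    (h : ∀ x, 0 ≤ x → f x = g x) : cfc f X = cfc g X :=
  cfc_congr fun x hx => h x (spectrum_nonneg hX hx)

theorem posSemidef_cfc {X : Matrix n n ℂ} (hX : X.PosSemidef) {f : ℝ → ℝ}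
    (hf : ∀ x, 0 ≤ x → 0 ≤ f x) : (cfc f X).PosSemidef :=
  Matrix.nonneg_iff_posSemidef.1 (cfc_nonneg fun x hx => hf x (spectrum_nonneg hX hx))

theorem cfc_le_cfc {X : Matrix n n ℂ} {f g : ℝ → ℝ}
    (h : ∀ x ∈ spectrum ℝ X, f x ≤ g x) : cfc f X ≤ cfc g X :=
  cfc_mono h (continuousOn_spectrum _ _) (continuousOn_spectrum _ _)

theorem posSemidef_matPow {X : Matrix n n ℂ} (hX : X.PosSemidef) (p : ℝ) :
    (matPow X p).PosSemidef :=
  posSemidef_cfc hX fun _ hx => Real.rpow_nonneg hx p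

theorem matPow_eq_rpow {X : Matrix n n ℂ} (hX : X.PosSemidef) (p : ℝ) : matPow X p = X ^ p :=
  (CFC.rpow_eq_cfc_real (ha := hX.nonneg)).symm

theorem matPow_one {X : Matrix n n ℂ} (hX : X.PosSemidef) : matPow X 1 = X := by
  rw [matPow]; simp only [Real.rpow_one]; exact cfc_id' ℝ X hX.1

theorem matPow_half_mul_self {X : Matrix n n ℂ} (hX : X.PosSemidef) (p : ℝ) :
    matPow X (p / 2) * matPow X (p / 2) = matPow X p := by
  rw [matPow, cfc_mul_cfc]
  refine cfc_congr_nonneg hX fun x hx => ?_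
  rcases hx.eq_or_lt with rfl | h
  · rcases eq_or_ne p 0 with rfl | hp
    · simp
    · simp [Real.zero_rpow, hp]
  · rw [← Real.rpow_add h, add_halves]

theorem sqrt_mul_sqrt {X : Matrix n n ℂ} (hX : X.PosSemidef) :
    matPow X (1 / 2) * matPow X (1 / 2) = X := by
  rw [matPow_half_mul_self hX, matPow_one hX]

theorem rtr_add (X Y : Matrix n n ℂ) : rtr (X + Y) = rtr X + rtr Y := by simp [rtr]

theorem rtr_sub (X Y : Matrix n n ℂ) : rtr (X - Y) = rtr X - rtr Y := by simp [rtr]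

theorem rtr_smul (c : ℝ) (X : Matrix n n ℂ) : rtr (c • X) = c * rtr X := by simp [rtr]

theorem rtr_mul_comm (X : Matrix m n ℂ) (Y : Matrix n m ℂ) : rtr (X * Y) = rtr (Y * X) := by
  rw [rtr, Matrix.trace_mul_comm, rtr]

theorem rtr_conjTranspose (X : Matrix n n ℂ) : rtr Xᴴ = rtr X := by
  simp [rtr, Matrix.trace_conjTranspose]

theorem rtr_nonneg {X : Matrix n n ℂ} (hX : X.PosSemidef) : 0 ≤ rtr X :=
  (Complex.le_def.1 hX.trace_nonneg).1

theorem rtr_mono {X Y : Matrix n n ℂ} (h : X ≤ Y) : rtr X ≤ rtr Y := by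
  have := rtr_nonneg (Matrix.le_iff.1 h)
  rw [rtr_sub] at this; linarith

theorem rtr_mul_nonneg {X Y : Matrix n n ℂ} (hX : X.PosSemidef) (hY : Y.PosSemidef) :
    0 ≤ rtr (X * Y) := by
  have h := rtr_nonneg (hY.conjTranspose_mul_mul_same (matPow X (1 / 2)))
  rwa [(posSemidef_matPow hX _).1.eq, rtr_mul_comm, ← mul_assoc, sqrt_mul_sqrt hX] at h

theorem rtr_mul_mono {X Y Z : Matrix n n ℂ} (hX : X.PosSemidef) (h : Y ≤ Z) :
    rtr (X * Y) ≤ rtr (X * Z) := by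
  have := rtr_mul_nonneg hX (Matrix.le_iff.1 h)
  rw [mul_sub, rtr_sub] at this; linarith

theorem conj_mono {X Y : Matrix m m ℂ} (h : X ≤ Y) (K : Matrix m n ℂ) :
    Kᴴ * X * K ≤ Kᴴ * Y * K := by
  rw [Matrix.le_iff] at h ⊢
  have := h.conjTranspose_mul_mul_same K
  rwa [Matrix.mul_sub, Matrix.sub_mul] at this

/-- The joint spectral distribution of a pair of Hermitian matrices. -/
theorem exists_spectral_weights {X Y : Matrix n n ℂ} (hX : X.IsHermitian) (hY : Y.IsHermitian) :
    ∃ w : n → n → ℝ, (∀ i j, 0 ≤ w i j) ∧ ∀ f g : ℝ → ℝ, rtr (cfc f X * cfc g Y) =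
      ∑ i, ∑ j, w i j * (f (hX.eigenvalues i) * g (hY.eigenvalues j)) := by
  let U : Matrix n n ℂ := hX.eigenvectorUnitary
  let U' : Matrix n n ℂ := hY.eigenvectorUnitary
  -- The weights are the squared overlaps |⟨u_i, v_j⟩|² of the two eigenbases.
  refine ⟨fun i j => Complex.normSq ((Uᴴ * U') i j), fun i j => Complex.normSq_nonneg _, ?_⟩
  intro f g
  have e1 : cfc f X = U * Matrix.diagonal (fun i => ((f (hX.eigenvalues i) : ℝ) : ℂ)) * Uᴴ := by
    rw [hX.cfc_eq]; rfl
  have e2 : cfc g Y = U' * Matrix.diagonal (fun i => ((g (hY.eigenvalues i) : ℝ) : ℂ)) * U'ᴴ := by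
    rw [hY.cfc_eq]; rfl
  set D := Matrix.diagonal (fun i => ((f (hX.eigenvalues i) : ℝ) : ℂ))
  set D' := Matrix.diagonal (fun i => ((g (hY.eigenvalues i) : ℝ) : ℂ))
  have e3 : cfc f X * cfc g Y = U * (D * (Uᴴ * U') * D' * U'ᴴ) := by
    rw [e1, e2]; simp only [mul_assoc]
  have e4 : rtr (cfc f X * cfc g Y) = rtr (D * (Uᴴ * U') * D' * (Uᴴ * U')ᴴ) := by
    rw [e3, rtr_mul_comm, Matrix.conjTranspose_mul, Matrix.conjTranspose_conjTranspose]
    simp only [mul_assoc]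
  rw [e4, rtr, Matrix.trace, Complex.re_sum]
  refine Finset.sum_congr rfl fun i _ => ?_
  rw [Matrix.diag_apply, Matrix.mul_apply, Complex.re_sum]
  refine Finset.sum_congr rfl fun j _ => ?_
  rw [Matrix.mul_diagonal, Matrix.diagonal_mul, Matrix.conjTranspose_apply]
  simp only [Complex.normSq_apply, Complex.star_def, Complex.mul_re, Complex.mul_im,
    Complex.conj_re, Complex.conj_im, Complex.ofReal_re, Complex.ofReal_im]
  ring

theorem rtr_cfc {X : Matrix n n ℂ} (hX : X.IsHermitian) (f : ℝ → ℝ) :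
    rtr (cfc f X) = ∑ i, f (hX.eigenvalues i) := by
  rw [hX.cfc_eq, Matrix.IsHermitian.cfc, rtr, Unitary.conjStarAlgAut_apply, Matrix.trace_mul_comm,
    ← mul_assoc]
  simp [Matrix.trace_diagonal]

/-- On two Hermitian matrices, any functional calculus is given by a common polynomial. -/
theorem exists_polynomial_cfc {X : Matrix m m ℂ} {Y : Matrix n n ℂ} (hX : X.IsHermitian)
    (hY : Y.IsHermitian) (f : ℝ → ℝ) :
    ∃ p : Polynomial ℝ, cfc f X = Polynomial.aeval X p ∧ cfc f Y = Polynomial.aeval Y p := by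
  have hfin : (spectrum ℝ X ∪ spectrum ℝ Y).Finite :=
    Matrix.finite_real_spectrum.union Matrix.finite_real_spectrum
  let s := hfin.toFinset
  let p := Lagrange.interpolate s id f
  have hp : ∀ x ∈ spectrum ℝ X ∪ spectrum ℝ Y, f x = p.eval x := fun x hx =>
    (Lagrange.eval_interpolate_at_node f (s := s) (v := id) Function.injective_id.injOn
      (hfin.mem_toFinset.2 hx)).symm
  refine ⟨p, ?_, ?_⟩
  · rw [← cfc_polynomial p X hX]
    exact cfc_congr fun x hx => hp x (Or.inl hx)
  · rw [← cfc_polynomial p Y hY]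
    exact cfc_congr fun x hx => hp x (Or.inr hx)

theorem aeval_intertwine {X : Matrix m m ℂ} {Y : Matrix n n ℂ} {V : Matrix m n ℂ}
    (h : X * V = V * Y) (p : Polynomial ℝ) :
    Polynomial.aeval X p * V = V * Polynomial.aeval Y p := by
  induction p using Polynomial.induction_on' with
  | add p q hp hq => rw [map_add, map_add, Matrix.add_mul, Matrix.mul_add, hp, hq]
  | monomial k a =>
    have hk : X ^ k * V = V * Y ^ k := by
      induction k with
      | zero => simp
      | succ k ih => rw [pow_succ, pow_succ, Matrix.mul_assoc, h, ← Matrix.mul_assoc, ih,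
          Matrix.mul_assoc]
    rw [Polynomial.aeval_monomial, Polynomial.aeval_monomial, Algebra.algebraMap_eq_smul_one,
      Algebra.algebraMap_eq_smul_one]
    simp [hk]

/-- One polynomial represents f on both spectra, and polynomials respect the intertwining; V need
not be square. -/
theorem cfc_intertwine {X : Matrix m m ℂ} {Y : Matrix n n ℂ} {V : Matrix m n ℂ}
    (hX : X.IsHermitian) (hY : Y.IsHermitian) (h : X * V = V * Y) (f : ℝ → ℝ) :
    cfc f X * V = V * cfc f Y := by
  obtain ⟨p, h1, h2⟩ := exists_polynomial_cfc hX hY f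
  rw [h1, h2, aeval_intertwine h]

theorem rtr_cfc_eq_roots {X : Matrix n n ℂ} (hX : X.IsHermitian) (f : ℝ → ℝ) :
    rtr (cfc f X) = (X.charpoly.roots.map fun z => f z.re).sum := by
  rw [rtr_cfc hX, hX.roots_charpoly_eq_eigenvalues, Multiset.map_map]
  simp [Function.comp_def]

/-- K*K and KK* have the same characteristic polynomial, and the trace of f(X) depends on nothing
else. -/
theorem rtr_cfc_conjTranspose_mul (f : ℝ → ℝ) (K : Matrix n n ℂ) :
    rtr (cfc f (Kᴴ * K)) = rtr (cfc f (K * Kᴴ)) := by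
  rw [rtr_cfc_eq_roots (Matrix.isHermitian_conjTranspose_mul_self K),
    rtr_cfc_eq_roots (Matrix.isHermitian_mul_conjTranspose_self K), Matrix.charpoly_mul_comm]

/-- The functional calculus commutes with conjugation by an isometry, for functions vanishing
at `0`. -/
theorem cfc_isometry_conj {V : Matrix m n ℂ} (hV : Vᴴ * V = 1) {X : Matrix n n ℂ}
    (hX : X.IsHermitian) {f : ℝ → ℝ} (h0 : f 0 = 0) :
    cfc f (V * X * Vᴴ) = V * cfc f X * Vᴴ := by
  have hVX : (V * X * Vᴴ).IsHermitian := Matrix.isHermitian_mul_mul_conjTranspose V hX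
  have h1 : cfc f (V * X * Vᴴ) * V = V * cfc f X :=
    cfc_intertwine hVX hX (by rw [Matrix.mul_assoc, hV, Matrix.mul_one]) f
  -- On the complement of the range of V, the matrix VXV* is intertwined with 0, so f acts there as
  -- f(0) = 0.
  have h2 : cfc f (V * X * Vᴴ) * (1 - V * Vᴴ) = (1 - V * Vᴴ) * cfc f (0 : Matrix m m ℂ) := by
    refine cfc_intertwine hVX Matrix.isHermitian_zero ?_ f
    rw [Matrix.mul_sub, Matrix.mul_assoc _ Vᴴ (V * Vᴴ), ← Matrix.mul_assoc Vᴴ V, hV]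
    simp
  have h3 : cfc f (0 : Matrix m m ℂ) = 0 := by rw [cfc_apply_zero, h0, map_zero]
  rw [h3, mul_zero, mul_sub, mul_one, sub_eq_zero, ← Matrix.mul_assoc, h1] at h2
  exact h2

theorem rtr_isometry_conj {V : Matrix m n ℂ} (hV : Vᴴ * V = 1) (X : Matrix n n ℂ) :
    rtr (V * X * Vᴴ) = rtr X := by
  rw [rtr_mul_comm, ← Matrix.mul_assoc, hV, Matrix.one_mul]

/-- Only finitely many eigenvalues matter, so pointwise limits suffice. This removes the
regularisations δ and η used below for singular matrices. -/
theorem tendsto_cfc_of_pointwise {ι : Type*} {l : Filter ι} {X : Matrix n n ℂ}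
    (hX : X.IsHermitian) {F : ι → ℝ → ℝ} {f : ℝ → ℝ}
    (h : ∀ x ∈ spectrum ℝ X, Filter.Tendsto (fun i => F i x) l (𝓝 (f x))) :
    Filter.Tendsto (fun i => cfc (F i) X) l (𝓝 (cfc f X)) := by
  simp only [hX.cfc_eq, Matrix.IsHermitian.cfc, Unitary.conjStarAlgAut_apply]
  refine (Filter.Tendsto.mul tendsto_const_nhds ?_).mul tendsto_const_nhds
  have : Filter.Tendsto (fun i => (RCLike.ofReal ∘ F i ∘ hX.eigenvalues : n → ℂ)) l
      (𝓝 (RCLike.ofReal ∘ f ∘ hX.eigenvalues)) := by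
    rw [tendsto_pi_nhds]
    intro j
    exact (RCLike.continuous_ofReal.tendsto _).comp (h _ (hX.eigenvalues_mem_spectrum_real j))
  exact ((continuous_id.matrix_diagonal).tendsto _).comp this

theorem continuous_rtr : Continuous (rtr : Matrix n n ℂ → ℝ) :=
  Complex.continuous_re.comp (continuous_id.matrix_trace)

theorem isClosed_posSemidef : IsClosed {X : Matrix n n ℂ | X.PosSemidef} := by
  simp_rw [← Matrix.nonneg_iff_posSemidef]
  exact CStarAlgebra.isClosed_nonneg

end FunctionalCalculus

/-! ### Operator Jensen, Klein and trace monotonicity for powers. -/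

section OperatorInequalities

open scoped MatrixOrder Matrix.Norms.L2Operator

variable {m n : Type*} [Fintype m] [DecidableEq m] [Fintype n] [DecidableEq n]

theorem matPow_mono {X Y : Matrix n n ℂ} (hX : X.PosSemidef) (h : X ≤ Y) {p : ℝ}
    (hp : p ∈ Set.Icc (0 : ℝ) 1) : matPow X p ≤ matPow Y p := by
  have hY : Y.PosSemidef := Matrix.nonneg_iff_posSemidef.1 (hX.nonneg.trans h)
  rw [matPow_eq_rpow hX, matPow_eq_rpow hY]
  exact CFC.rpow_le_rpow hp h

theorem matPow_concave {X Y : Matrix n n ℂ} (hX : X.PosSemidef) (hY : Y.PosSemidef) {p a b : ℝ}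
    (hp : p ∈ Set.Icc (0 : ℝ) 1) (ha : 0 ≤ a) (hb : 0 ≤ b) (hab : a + b = 1) :
    a • matPow X p + b • matPow Y p ≤ matPow (a • X + b • Y) p := by
  have h := (CFC.concaveOn_rpow (A := Matrix n n ℂ) hp).2 hX.nonneg hY.nonneg ha hb hab
  have hXY : (a • X + b • Y).PosSemidef :=
    Matrix.nonneg_iff_posSemidef.1
      (add_nonneg (smul_nonneg ha hX.nonneg) (smul_nonneg hb hY.nonneg))
  rwa [matPow_eq_rpow hX, matPow_eq_rpow hY, matPow_eq_rpow hXY]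

theorem posSemidef_compress {X : Matrix m m ℂ} (hX : X.PosSemidef) (V : Matrix m n ℂ) :
    (Vᴴ * X * V).PosSemidef := hX.conjTranspose_mul_mul_same V

/-- Operator Jensen inequality for fractional powers and compressions by isometries. -/
theorem matPow_jensen {V : Matrix m n ℂ} (hV : Vᴴ * V = 1) {X : Matrix m m ℂ}
    (hX : X.PosSemidef) {p : ℝ} (hp : p ∈ Set.Icc (0 : ℝ) 1) :
    Vᴴ * matPow X p * V ≤ matPow (Vᴴ * X * V) p := by
  -- U is the reflection fixing the range of V. The average Z of X and UXU leaves that range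
  -- invariant and restricts to V*XV on it, so operator concavity applied to the average yields the
  -- inequality after compression.
  set U : Matrix m m ℂ := (2 : ℝ) • (V * Vᴴ) - 1 with hU
  have hUh : Uᴴ = U := by simp [hU]
  have hUV : U * V = V := by
    rw [hU, Matrix.sub_mul, Matrix.smul_mul, Matrix.mul_assoc, hV, Matrix.mul_one, Matrix.one_mul,
      two_smul]; abel
  have hVU : Vᴴ * U = Vᴴ := by
    have := congrArg Matrix.conjTranspose hUV
    rwa [Matrix.conjTranspose_mul, hUh] at this
  have hUU : U * U = 1 := by
    conv_lhs => enter [1]; rw [hU]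
    rw [Matrix.sub_mul, Matrix.smul_mul, Matrix.mul_assoc, hVU, Matrix.one_mul, hU]; abel
  have hUX : (U * X * U).PosSemidef := by
    have := posSemidef_compress hX U; rwa [hUh] at this
  have hc := matPow_concave hX hUX hp (a := 1 / 2) (b := 1 / 2) (by norm_num) (by norm_num)
    (by norm_num)
  have h1 : matPow (U * X * U) p * U = U * matPow X p :=
    cfc_intertwine hUX.1 hX.1 (by rw [Matrix.mul_assoc, hUU, Matrix.mul_one]) _
  have h2 : matPow (U * X * U) p = U * matPow X p * U := by
    rw [← h1, Matrix.mul_assoc _ U U, hUU, Matrix.mul_one]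
  set Z := (1 / 2 : ℝ) • X + (1 / 2 : ℝ) • (U * X * U) with hZ
  have hZh : Z.PosSemidef :=
    Matrix.nonneg_iff_posSemidef.1 (add_nonneg (smul_nonneg (by norm_num) hX.nonneg)
      (smul_nonneg (by norm_num) hUX.nonneg))
  have hVX := posSemidef_compress hX V
  have h3 : Z * V = V * (Vᴴ * X * V) := by
    have : U * X * U * V = (2 : ℝ) • (V * Vᴴ * X * V) - X * V := by
      rw [Matrix.mul_assoc _ U V, hUV, hU]
      simp only [Matrix.sub_mul, Matrix.smul_mul, Matrix.one_mul]
    rw [hZ, Matrix.add_mul, Matrix.smul_mul, Matrix.smul_mul, this, smul_sub, smul_smul]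
    simp only [Matrix.mul_assoc]
    norm_num
  have h4 := conj_mono hc V
  have h5 : matPow Z p * V = V * matPow (Vᴴ * X * V) p := cfc_intertwine hZh.1 hVX.1 h3 _
  rw [Matrix.mul_assoc _ (matPow Z p), h5, ← Matrix.mul_assoc, hV, Matrix.one_mul, h2] at h4
  refine le_trans (le_of_eq ?_) h4
  have h6 : Vᴴ * (U * matPow X p * U) * V = Vᴴ * matPow X p * V := by
    rw [Matrix.mul_assoc _ _ V, Matrix.mul_assoc _ U V, hUV, Matrix.mul_assoc U, ← Matrix.mul_assoc,
      hVU, Matrix.mul_assoc]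
  rw [Matrix.mul_add, Matrix.add_mul, Matrix.mul_smul, Matrix.smul_mul, Matrix.mul_smul,
    Matrix.smul_mul, h6, ← add_smul]
  norm_num

/-- If `F` dominates the compression of `B`, then `F⁻¹` is dominated by the compression of
`B⁻¹`. -/
theorem inv_le_compress_inv {V : Matrix m n ℂ} (hV : Vᴴ * V = 1) {B B' : Matrix m m ℂ}
    {F G : Matrix n n ℂ} (hB : B.IsHermitian) (hB' : B'.PosSemidef) (hBB' : B * B' = 1)
    (hG : G.IsHermitian) (hFG : F * G = 1) (h : Vᴴ * B * V ≤ F) : G ≤ Vᴴ * B' * V := by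
  have hB'B : B' * B = 1 := mul_eq_one_comm.1 hBB'
  -- Completing the square: this positive matrix expands to V*B'V - 2G + G(V*BV)G, whose last term
  -- is at most GFG = G.
  have h1 := (posSemidef_compress hB' (V - B * V * G)).nonneg
  have h2 : (V - B * V * G)ᴴ * B' * (V - B * V * G) =
      Vᴴ * B' * V - G - G + G * (Vᴴ * B * V) * G := by
    have e1 : (V - B * V * G)ᴴ * B' = Vᴴ * B' - G * Vᴴ := by
      rw [Matrix.conjTranspose_sub, Matrix.sub_mul, Matrix.conjTranspose_mul,
        Matrix.conjTranspose_mul, hG.eq, hB.eq, Matrix.mul_assoc, Matrix.mul_assoc, hBB',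
        Matrix.mul_one]
    have e2 : Vᴴ * B' * (B * V * G) = G := by
      rw [Matrix.mul_assoc, Matrix.mul_assoc B, ← Matrix.mul_assoc B', hB'B, Matrix.one_mul,
        ← Matrix.mul_assoc, hV, Matrix.one_mul]
    have e3 : G * Vᴴ * V = G := by rw [Matrix.mul_assoc, hV, Matrix.mul_one]
    rw [e1, Matrix.mul_sub, Matrix.sub_mul, Matrix.sub_mul, e2, e3]
    simp only [Matrix.mul_assoc]
    abel
  have h3 := conj_mono h G
  rw [hG.eq, Matrix.mul_assoc G F G, hFG, Matrix.mul_one] at h3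
  rw [h2] at h1
  have h4 : 0 ≤ Vᴴ * B' * V - G - G + G := h1.trans (by gcongr)
  rwa [sub_add_cancel, sub_nonneg] at h4

theorem cfc_add_const {X : Matrix n n ℂ} (hX : X.IsHermitian) (δ : ℝ) :
    cfc (fun x : ℝ => x + δ) X = X + δ • 1 := by
  rw [← cfc_add_cfc, cfc_self hX, cfc_const_eq hX]

theorem matPow_add_const {X : Matrix n n ℂ} (hX : X.IsHermitian) (δ p : ℝ) :
    matPow (X + δ • 1) p = cfc (fun x : ℝ => (x + δ) ^ p) X := by
  rw [← cfc_add_const hX, matPow, cfc_cfc _ _ hX]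

theorem posSemidef_add_const {X : Matrix n n ℂ} (hX : X.PosSemidef) {δ : ℝ} (hδ : 0 ≤ δ) :
    (X + δ • 1).PosSemidef := by
  rw [← cfc_add_const hX.1]
  exact posSemidef_cfc hX fun x hx => by positivity

theorem cfc_shift_mul_cfc_shift {X : Matrix n n ℂ} (hX : X.PosSemidef) {δ : ℝ} (hδ : 0 < δ)
    (p : ℝ) : cfc (fun x : ℝ => (x + δ) ^ p) X * cfc (fun x : ℝ => (x + δ) ^ (-p)) X = 1 := by
  rw [cfc_mul_cfc, ← cfc_one ℝ X hX.1.isSelfAdjoint]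
  refine cfc_congr_nonneg hX fun x hx => ?_
  have : 0 < x + δ := by positivity
  rw [← Real.rpow_add this]; simp

/-- Operator Jensen inequality for negative fractional powers. -/
theorem cfc_shift_jensen {V : Matrix m n ℂ} (hV : Vᴴ * V = 1) {X : Matrix m m ℂ}
    (hX : X.PosSemidef) {δ t : ℝ} (hδ : 0 < δ) (ht : t ∈ Set.Icc (0 : ℝ) 1) :
    cfc (fun x : ℝ => (x + δ) ^ (-t)) (Vᴴ * X * V) ≤
      Vᴴ * cfc (fun x : ℝ => (x + δ) ^ (-t)) X * V := by
  have hVX := posSemidef_compress hX V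
  -- Invert the Jensen inequality for the positive power t of X + δ; the shift makes everything
  -- invertible.
  refine inv_le_compress_inv hV (isHermitian_cfc _ _)
    (posSemidef_cfc hX fun x hx => by positivity) (cfc_shift_mul_cfc_shift hX hδ t)
    (isHermitian_cfc _ _) (cfc_shift_mul_cfc_shift hVX hδ t) ?_
  have h := matPow_jensen hV (posSemidef_add_const hX hδ.le) ht
  have e : Vᴴ * (X + δ • 1) * V = Vᴴ * X * V + δ • 1 := by
    rw [Matrix.mul_add, Matrix.add_mul]; simp [hV]
  rwa [e, matPow_add_const hX.1, matPow_add_const hVX.1] at h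

/-- Löwner–Heinz for the positive power followed by inversion, which is the compression lemma with V
= 1. -/
theorem cfc_shift_antitone {X Y : Matrix n n ℂ} (hX : X.PosSemidef) (h : X ≤ Y)
    {δ t : ℝ} (hδ : 0 < δ) (ht : t ∈ Set.Icc (0 : ℝ) 1) :
    cfc (fun x : ℝ => (x + δ) ^ (-t)) Y ≤ cfc (fun x : ℝ => (x + δ) ^ (-t)) X := by
  have hY : Y.PosSemidef := Matrix.nonneg_iff_posSemidef.1 (hX.nonneg.trans h)
  have h1 := inv_le_compress_inv (V := (1 : Matrix n n ℂ)) (by simp) (isHermitian_cfc _ _)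
    (posSemidef_cfc hX fun x hx => by positivity) (cfc_shift_mul_cfc_shift hX hδ t)
    (isHermitian_cfc _ Y) (cfc_shift_mul_cfc_shift hY hδ t) ?_
  · simpa using h1
  · have h2 := matPow_mono (posSemidef_add_const hX hδ.le) (add_le_add_left h (δ • 1)) ht
    rw [matPow_add_const hX.1, matPow_add_const hY.1] at h2
    simpa using h2

/-- Klein's inequality. -/
theorem klein_nonneg {X Y : Matrix n n ℂ} (hX : X.PosSemidef) (hY : Y.PosSemidef)
    {f g h : ℝ → ℝ} (H : ∀ x y, 0 ≤ x → 0 ≤ y → 0 ≤ f x + g y + h y * x) :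
    0 ≤ rtr (cfc f X) + rtr (cfc g Y) + rtr (cfc h Y * X) := by
  -- In the joint spectral weights, the three traces become one nonnegative combination of the
  -- scalar inequalities H.
  obtain ⟨w, hw, hfg⟩ := exists_spectral_weights hX.1 hY.1
  have e1 := hfg f (fun _ => 1)
  have e2 := hfg (fun _ => 1) g
  have e3 := hfg (fun x => x) h
  rw [cfc_const_eq hY.1, one_smul, mul_one] at e1
  rw [cfc_const_eq hX.1, one_smul, one_mul] at e2
  rw [cfc_self hX.1, rtr_mul_comm] at e3
  rw [e1, e2, e3, ← Finset.sum_add_distrib, ← Finset.sum_add_distrib]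
  refine Finset.sum_nonneg fun i _ => ?_
  rw [← Finset.sum_add_distrib, ← Finset.sum_add_distrib]
  refine Finset.sum_nonneg fun j _ => ?_
  have := mul_nonneg (hw i j) (H _ _ (hX.eigenvalues_nonneg i) (hY.eigenvalues_nonneg j))
  linarith

/-- A convex power lies above its tangent at y: this is Bernoulli's inequality for x / y, rescaled
by y ^ α. -/
theorem rpow_tangent_le {α x y : ℝ} (hα : 1 < α) (hx : 0 ≤ x) (hy : 0 ≤ y) :
    (1 - α) * y ^ α + α * y ^ (α - 1) * x ≤ x ^ α := by
  rcases hy.eq_or_lt with rfl | hy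
  · rw [Real.zero_rpow (by linarith), Real.zero_rpow (by linarith)]
    simpa using Real.rpow_nonneg hx α
  · have h := one_add_mul_self_le_rpow_one_add (s := x / y - 1) (p := α)
      (by have := div_nonneg hx hy.le; linarith) hα.le
    rw [add_sub_cancel, Real.div_rpow hx hy.le, le_div_iff₀ (by positivity)] at h
    rw [Real.rpow_sub_one hy.ne']
    calc _ = (1 + α * (x / y - 1)) * y ^ α := by field_simp; ring
      _ ≤ _ := h

/-- Here y must be positive: with 0 ^ (α - 1) = 0 the right side would vanish at y = 0. This forces
the shift η in the matrix version. -/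
theorem le_rpow_tangent {α x y : ℝ} (h0 : 0 < α) (hα : α < 1) (hx : 0 ≤ x) (hy : 0 < y) :
    x ^ α ≤ (1 - α) * y ^ α + α * y ^ (α - 1) * x := by
  have h := rpow_one_add_le_one_add_mul_self (s := x / y - 1) (p := α)
    (by have := div_nonneg hx hy.le; linarith) h0.le hα.le
  rw [add_sub_cancel, Real.div_rpow hx hy.le, div_le_iff₀ (by positivity)] at h
  rw [Real.rpow_sub_one hy.ne']
  calc _ ≤ (1 + α * (x / y - 1)) * y ^ α := h
    _ = _ := by field_simp; ring

theorem rtr_matPow_tangent_le {X Y : Matrix n n ℂ} (hX : X.PosSemidef) (hY : Y.PosSemidef)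
    {α : ℝ} (hα : 1 < α) :
    (1 - α) * rtr (matPow Y α) + α * rtr (matPow Y (α - 1) * X) ≤ rtr (matPow X α) := by
  have h := klein_nonneg hX hY (f := fun x => x ^ α) (g := fun y => (α - 1) * y ^ α)
    (h := fun y => -α * y ^ (α - 1)) fun x y hx hy => by
      have := rpow_tangent_le hα hx hy; linarith
  rw [cfc_const_mul _ _ _ (continuousOn_spectrum _ _),
    cfc_const_mul _ _ _ (continuousOn_spectrum _ _), rtr_smul, smul_mul_assoc, rtr_smul] at h
  simp only [matPow]
  linarith

theorem rtr_matPow_le_tangent {X Y : Matrix n n ℂ} (hX : X.PosSemidef) (hY : Y.PosSemidef)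
    {α η : ℝ} (h0 : 0 < α) (hα : α < 1) (hη : 0 < η) :
    rtr (matPow X α) ≤ (1 - α) * rtr (cfc (fun y : ℝ => (y + η) ^ α) Y) +
      α * rtr (cfc (fun y : ℝ => (y + η) ^ (α - 1)) Y * X) := by
  have h := klein_nonneg hX hY (f := fun x => (-1) * x ^ α) (g := fun y => (1 - α) * (y + η) ^ α)
    (h := fun y => α * (y + η) ^ (α - 1)) fun x y hx hy => by
      have := le_rpow_tangent h0 hα hx (show 0 < y + η by positivity); linarith
  rw [cfc_const_mul _ _ _ (continuousOn_spectrum _ _),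
    cfc_const_mul _ _ _ (continuousOn_spectrum _ _),
    cfc_const_mul _ _ _ (continuousOn_spectrum _ _), rtr_smul, rtr_smul, smul_mul_assoc,
    rtr_smul] at h
  simp only [matPow]
  linarith

theorem matPow_sub_one_mul {X : Matrix n n ℂ} (hX : X.PosSemidef) {α : ℝ} (hα : α ≠ 0) :
    matPow X (α - 1) * X = matPow X α := by
  conv_lhs => enter [2]; rw [← matPow_one hX]
  rw [matPow, matPow, cfc_mul_cfc]
  refine cfc_congr_nonneg hX fun x hx => ?_
  rcases hx.eq_or_lt with rfl | hx
  · simp [Real.zero_rpow hα]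
  · rw [← Real.rpow_add hx]; simp

/-- Up to α = 1 the power itself is operator monotone. Beyond, only the trace is: expand tr Y^α
around its tangent at X and use tr(X^(α-1) Y) ≥ tr X^α. -/
theorem rtr_matPow_mono {X Y : Matrix n n ℂ} (hX : X.PosSemidef) (h : X ≤ Y) {α : ℝ}
    (hα : 0 < α) : rtr (matPow X α) ≤ rtr (matPow Y α) := by
  have hY : Y.PosSemidef := Matrix.nonneg_iff_posSemidef.1 (hX.nonneg.trans h)
  rcases le_or_gt α 1 with h1 | h1
  · exact rtr_mono (matPow_mono hX h ⟨hα.le, h1⟩)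
  · have h2 := rtr_matPow_tangent_le hY hX h1
    have h3 := rtr_mul_mono (posSemidef_matPow hX (α - 1)) h
    rw [matPow_sub_one_mul hX hα.ne'] at h3
    nlinarith

end OperatorInequalities

/-! ### Kernel projections and support conditions. -/

section Supports

open scoped MatrixOrder Matrix.Norms.L2Operator

variable {m n : Type*} [Fintype m] [DecidableEq m] [Fintype n] [DecidableEq n]

/-- The orthogonal projection onto the kernel of a Hermitian matrix. -/
noncomputable def kerProj (σ : Matrix n n ℂ) : Matrix n n ℂ :=
  cfc (fun x : ℝ => if x = 0 then 1 else 0) σ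

theorem posSemidef_kerProj {σ : Matrix n n ℂ} (hσ : σ.PosSemidef) : (kerProj σ).PosSemidef :=
  posSemidef_cfc hσ fun x _ => by positivity

theorem kerProj_mul_self {σ : Matrix n n ℂ} (hσ : σ.IsHermitian) : kerProj σ * σ = 0 := by
  conv_lhs => enter [2]; rw [← cfc_self hσ]
  rw [kerProj, cfc_mul_cfc, ← cfc_const_zero ℝ σ]
  exact cfc_congr fun x _ => by by_cases h : x = 0 <;> simp [h]

theorem kerProj_mul_kerProj (σ : Matrix n n ℂ) : kerProj σ * kerProj σ = kerProj σ := by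
  rw [kerProj, cfc_mul_cfc]
  exact cfc_congr fun x _ => by by_cases h : x = 0 <;> simp [h]

theorem self_mul_pinv {σ : Matrix n n ℂ} (hσ : σ.IsHermitian) :
    σ * cfc (fun x : ℝ => x⁻¹) σ = 1 - kerProj σ := by
  conv_lhs => enter [1]; rw [← cfc_self hσ]
  rw [kerProj, cfc_mul_cfc, ← cfc_one ℝ σ hσ.isSelfAdjoint, cfc_sub_cfc]
  exact cfc_congr fun x _ => by by_cases h : x = 0 <;> simp [h]

theorem suppLE_iff {ρ σ : Matrix n n ℂ} (hσ : σ.IsHermitian) :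
    SuppLE ρ σ ↔ kerProj σ * ρ = 0 := by
  constructor
  · intro h
    refine Matrix.ext_of_mulVec_single fun i => ?_
    obtain ⟨w, hw⟩ := h ⟨Pi.single i 1, rfl⟩
    rw [Matrix.mulVecLin_apply, Matrix.mulVecLin_apply] at hw
    rw [← Matrix.mulVec_mulVec, ← hw, Matrix.mulVec_mulVec, kerProj_mul_self hσ]
    simp only [Matrix.zero_mulVec]
  · rintro h _ ⟨v, rfl⟩
    refine ⟨(cfc (fun x : ℝ => x⁻¹) σ * ρ) *ᵥ v, ?_⟩
    rw [Matrix.mulVecLin_apply, Matrix.mulVecLin_apply, Matrix.mulVec_mulVec, ← mul_assoc,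
      self_mul_pinv hσ, sub_mul, h, one_mul, sub_zero]

theorem eq_zero_of_rtr_eq_zero {X : Matrix n n ℂ} (hX : X.PosSemidef) (h : rtr X = 0) :
    X = 0 := by
  refine hX.trace_eq_zero_iff.1 (Complex.ext h ?_)
  exact (Complex.le_def.1 hX.trace_nonneg).2.symm

theorem mul_eq_zero_of_compress_eq_zero {X : Matrix m m ℂ} (hX : X.PosSemidef)
    {K : Matrix m n ℂ} (h : Kᴴ * X * K = 0) : X * K = 0 := by
  have h1 : (matPow X (1 / 2) * K)ᴴ * (matPow X (1 / 2) * K) = 0 := by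
    rw [Matrix.conjTranspose_mul, (posSemidef_matPow hX _).1.eq, Matrix.mul_assoc,
      ← Matrix.mul_assoc _ _ K, sqrt_mul_sqrt hX, ← Matrix.mul_assoc, h]
  rw [Matrix.conjTranspose_mul_self_eq_zero] at h1
  rw [← sqrt_mul_sqrt hX, Matrix.mul_assoc, h1, Matrix.mul_zero]

theorem suppLE_iff_rtr {ρ σ : Matrix n n ℂ} (hρ : ρ.PosSemidef) (hσ : σ.PosSemidef) :
    SuppLE ρ σ ↔ rtr (ρ * kerProj σ) = 0 := by
  have hK := posSemidef_kerProj hσ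
  rw [suppLE_iff hσ.1]
  constructor
  · intro h
    rw [rtr_mul_comm, h]; simp [rtr]
  · intro h
    have h1 : rtr ((kerProj σ)ᴴ * ρ * kerProj σ) = 0 := by
      rw [hK.1.eq, mul_assoc, rtr_mul_comm, mul_assoc, kerProj_mul_kerProj, h]
    have h2 := mul_eq_zero_of_compress_eq_zero hρ
      (eq_zero_of_rtr_eq_zero (posSemidef_compress hρ _) h1)
    simpa [hρ.1.eq, hK.1.eq] using congrArg Matrix.conjTranspose h2

/-- tr(ρ · `kerProj σ`) = 0 is a sum of nonnegative terms, so each vanishes. Thus a zero eigenvalue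
of σ, where log and negative powers take junk values, never contributes. -/
theorem exists_spectral_weights_of_suppLE {ρ σ : Matrix n n ℂ} (hρ : ρ.PosSemidef)
    (hσ : σ.PosSemidef) (h : SuppLE ρ σ) : ∃ w : n → n → ℝ, (∀ i j, 0 ≤ w i j) ∧
      (∀ f g : ℝ → ℝ, rtr (cfc f ρ * cfc g σ) =
        ∑ i, ∑ j, w i j * (f (hρ.1.eigenvalues i) * g (hσ.1.eigenvalues j))) ∧
      ∀ i j, 0 < hσ.1.eigenvalues j ∨ w i j = 0 ∨ hρ.1.eigenvalues i = 0 := by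
  obtain ⟨w, hw, hfg⟩ := exists_spectral_weights hρ.1 hσ.1
  refine ⟨w, hw, hfg, fun i j => ?_⟩
  have e1 := hfg (fun x => x) (fun x => if x = 0 then 1 else 0)
  have e0 : rtr (ρ * cfc (fun x : ℝ => if x = 0 then 1 else 0) σ) = 0 :=
    (suppLE_iff_rtr hρ hσ).1 h
  rw [cfc_self hρ.1, e0] at e1
  have hnn : ∀ i j, 0 ≤ w i j * (hρ.1.eigenvalues i *
      (if hσ.1.eigenvalues j = 0 then 1 else 0)) := fun i j =>
    mul_nonneg (hw i j) (mul_nonneg (hρ.eigenvalues_nonneg i) (by positivity))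
  have h1 := (Finset.sum_eq_zero_iff_of_nonneg
    (fun i _ => Finset.sum_nonneg fun j _ => hnn i j)).1 e1.symm i (Finset.mem_univ _)
  have h2 := (Finset.sum_eq_zero_iff_of_nonneg (fun j _ => hnn i j)).1 h1 j (Finset.mem_univ _)
  rcases (hσ.eigenvalues_nonneg j).eq_or_lt with h0 | h0
  · rw [if_pos h0.symm, mul_one] at h2
    exact Or.inr (mul_eq_zero.1 h2)
  · exact Or.inl h0

theorem kerProj_mul_sqrt {ρ σ : Matrix n n ℂ} (hρ : ρ.PosSemidef) (hσ : σ.PosSemidef)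
    (h : SuppLE ρ σ) : kerProj σ * matPow ρ (1 / 2) = 0 := by
  rw [suppLE_iff hσ.1] at h
  have hK := posSemidef_kerProj hσ
  have h1 : (kerProj σ * matPow ρ (1 / 2)) * (kerProj σ * matPow ρ (1 / 2))ᴴ = 0 := by
    rw [Matrix.conjTranspose_mul, (posSemidef_matPow hρ _).1.eq, mul_assoc,
      ← mul_assoc _ _ (kerProj σ)ᴴ, sqrt_mul_sqrt hρ, ← mul_assoc, h, zero_mul]
  exact Matrix.self_mul_conjTranspose_eq_zero.1 h1

/-- The two sandwiched matrices are K*K and KK* for K = √ρ σ^((1-α)/2α). The second form has an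
undivided power of σ in the middle, where operator inequalities apply. -/
theorem sandwichTr_eq {ρ σ : Matrix n n ℂ} (hρ : ρ.PosSemidef) (hσ : σ.PosSemidef) (α : ℝ) :
    sandwichTr α ρ σ =
      rtr (matPow (matPow ρ (1 / 2) * matPow σ ((1 - α) / α) * matPow ρ (1 / 2)) α) := by
  have e : (1 - α) / (2 * α) = (1 - α) / α / 2 := by rw [div_div, mul_comm]
  have h := rtr_cfc_conjTranspose_mul (fun x : ℝ => x ^ α)
    (matPow ρ (1 / 2) * matPow σ ((1 - α) / α / 2))
  rw [Matrix.conjTranspose_mul, (posSemidef_matPow hρ _).1.eq, (posSemidef_matPow hσ _).1.eq] at h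
  have e1 : matPow σ ((1 - α) / α / 2) * matPow ρ (1 / 2) *
      (matPow ρ (1 / 2) * matPow σ ((1 - α) / α / 2)) =
      matPow σ ((1 - α) / α / 2) * ρ * matPow σ ((1 - α) / α / 2) := by
    conv_rhs => rw [← sqrt_mul_sqrt hρ]
    simp only [mul_assoc]
  have e2 : matPow ρ (1 / 2) * matPow σ ((1 - α) / α / 2) *
      (matPow σ ((1 - α) / α / 2) * matPow ρ (1 / 2)) =
      matPow ρ (1 / 2) * matPow σ ((1 - α) / α) * matPow ρ (1 / 2) := by
    conv_rhs => rw [← matPow_half_mul_self hσ]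
    simp only [mul_assoc]
  rw [e1, e2] at h
  rw [sandwichTr, e]
  exact h

end Supports

/-! ### Partial trace and operators of the form 1 ⊗ σ. -/

section Tensor

open scoped MatrixOrder Matrix.Norms.L2Operator

variable {A E : Type*} [Fintype A] [DecidableEq A] [Fintype E] [DecidableEq E]

theorem oneTensor_mul (X Y : Matrix A A ℂ) :
    oneTensor E (X * Y) = oneTensor E X * oneTensor E Y := by
  rw [oneTensor, oneTensor, oneTensor, ← Matrix.mul_kronecker_mul, Matrix.one_mul]

theorem oneTensor_conjTranspose (X : Matrix A A ℂ) : (oneTensor E X)ᴴ = oneTensor E Xᴴ := by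
  rw [oneTensor, Matrix.conjTranspose_kronecker, Matrix.conjTranspose_one, oneTensor]

theorem posSemidef_oneTensor {X : Matrix A A ℂ} (hX : X.PosSemidef) :
    (oneTensor E X).PosSemidef := Matrix.PosSemidef.one.kronecker hX

theorem isHermitian_oneTensor {X : Matrix A A ℂ} (hX : X.IsHermitian) :
    (oneTensor E X).IsHermitian := by
  rw [Matrix.IsHermitian, oneTensor_conjTranspose, hX.eq]

theorem cfc_oneTensor {X : Matrix A A ℂ} (hX : X.IsHermitian) (f : ℝ → ℝ) :
    cfc f (oneTensor E X) = oneTensor E (cfc f X) := by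
  obtain ⟨p, h1, h2⟩ := exists_polynomial_cfc (isHermitian_oneTensor (E := E) hX) hX f
  rw [h1, h2]
  clear h1 h2
  induction p using Polynomial.induction_on' with
  | add p q hp hq => rw [map_add, map_add, hp, hq, oneTensor, oneTensor, oneTensor,
      Matrix.kronecker_add]
  | monomial k a =>
    have hk : oneTensor E X ^ k = oneTensor E (X ^ k) := by
      induction k with
      | zero => simp [oneTensor]
      | succ k ih => rw [pow_succ, pow_succ, oneTensor_mul, ih]
    rw [Polynomial.aeval_monomial, Polynomial.aeval_monomial, Algebra.algebraMap_eq_smul_one,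
      Algebra.algebraMap_eq_smul_one, hk, smul_mul_assoc, smul_mul_assoc, one_mul, one_mul,
      oneTensor, oneTensor, Matrix.kronecker_smul]

theorem trace_mul_oneTensor (τ : Matrix (E × A) (E × A) ℂ) (X : Matrix A A ℂ) :
    (τ * oneTensor E X).trace = (ptraceE τ * X).trace := by
  simp only [Matrix.trace, Matrix.diag_apply, Matrix.mul_apply, oneTensor, ptraceE,
    Matrix.kroneckerMap_apply, Matrix.one_apply, Matrix.of_apply, Fintype.sum_prod_type,
    ite_mul, one_mul, zero_mul, mul_ite, mul_zero, Finset.sum_mul]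
  rw [Finset.sum_comm]
  refine Finset.sum_congr rfl fun i _ => ?_
  have : ∀ k : E, (∑ l : E, ∑ j : A, if l = k then τ (k, i) (l, j) * X j i else 0) =
      ∑ j : A, τ (k, i) (k, j) * X j i := by
    intro k
    rw [Finset.sum_comm]
    simp
  simp only [this]
  rw [Finset.sum_comm]

theorem rtr_mul_oneTensor (τ : Matrix (E × A) (E × A) ℂ) (X : Matrix A A ℂ) :
    rtr (τ * oneTensor E X) = rtr (ptraceE τ * X) := by
  rw [rtr, trace_mul_oneTensor, rtr]

theorem oneTensor_one : oneTensor E (1 : Matrix A A ℂ) = 1 := by simp [oneTensor]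

theorem trace_ptraceE (τ : Matrix (E × A) (E × A) ℂ) : (ptraceE τ).trace = τ.trace := by
  have := trace_mul_oneTensor τ 1
  rw [oneTensor_one, mul_one, mul_one] at this
  exact this.symm

theorem posSemidef_ptraceE {τ : Matrix (E × A) (E × A) ℂ} (hτ : τ.PosSemidef) :
    (ptraceE τ).PosSemidef := by
  have : ptraceE τ = ∑ k : E, τ.submatrix (fun i => (k, i)) (fun i => (k, i)) := by
    ext i j
    rw [Matrix.sum_apply]
    rfl
  rw [this]
  exact Matrix.posSemidef_sum _ fun k _ => hτ.submatrix _

theorem isState_ptraceE {τ : Matrix (E × A) (E × A) ℂ} (hτ : IsState τ) : IsState (ptraceE τ) :=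
  ⟨posSemidef_ptraceE hτ.1, by rw [trace_ptraceE, hτ.2]⟩

theorem kerProj_oneTensor {σ : Matrix A A ℂ} (hσ : σ.IsHermitian) :
    kerProj (oneTensor E σ) = oneTensor E (kerProj σ) := cfc_oneTensor hσ _

theorem matPow_oneTensor {σ : Matrix A A ℂ} (hσ : σ.IsHermitian) (p : ℝ) :
    matPow (oneTensor E σ) p = oneTensor E (matPow σ p) := cfc_oneTensor hσ _

theorem matLog_oneTensor {σ : Matrix A A ℂ} (hσ : σ.IsHermitian) :
    matLog (oneTensor E σ) = oneTensor E (matLog σ) := cfc_oneTensor hσ _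

/-- Both sides say that a trace against the kernel projection of σ vanishes, and the partial trace
preserves that pairing. -/
theorem suppLE_oneTensor_iff {τ : Matrix (E × A) (E × A) ℂ} {σ : Matrix A A ℂ}
    (hτ : τ.PosSemidef) (hσ : σ.PosSemidef) :
    SuppLE τ (oneTensor E σ) ↔ SuppLE (ptraceE τ) σ := by
  rw [suppLE_iff_rtr hτ (posSemidef_oneTensor hσ), suppLE_iff_rtr (posSemidef_ptraceE hτ) hσ,
    kerProj_oneTensor hσ.1, rtr_mul_oneTensor]

theorem suppLE_refl (ρ : Matrix A A ℂ) : SuppLE ρ ρ := le_rfl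

end Tensor

/-! ### The conditional expectation and its Stinespring isometry. -/

section ConditionalExpectation

variable {A E : Type*} [Fintype A] [DecidableEq A] [Fintype E] [DecidableEq E]
  {N : StarSubalgebra ℂ (Matrix A A ℂ)} {V : Matrix (E × A) A ℂ}

/-- The difference of the two sides lies in N and is orthogonal to N, hence to itself. -/
theorem condExp_of_mem {x : Matrix A A ℂ} (hx : x ∈ N) : condExp N x = x := by
  rw [← sub_eq_zero]
  set d := condExp N x - x with hd
  have hdN : d ∈ N := sub_mem (condExp_mem N x) hx
  have h := trace_mul_condExp N (star_mem hdN) x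
  have h2 : (dᴴ * d).trace = 0 := by
    rw [hd, mul_sub, Matrix.trace_sub, ← hd]
    exact sub_eq_zero.2 h
  exact Matrix.trace_conjTranspose_mul_self_eq_zero_iff.1 h2

theorem trace_condExp_mul (x y : Matrix A A ℂ) :
    (condExp N x * y).trace = (x * condExp N y).trace := by
  rw [← trace_mul_condExp N (condExp_mem N x) y, Matrix.trace_mul_comm,
    trace_mul_condExp N (condExp_mem N y) x, Matrix.trace_mul_comm]

theorem trace_condExp (x : Matrix A A ℂ) : (condExp N x).trace = x.trace := by
  have := trace_mul_condExp N (one_mem N) x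
  rwa [one_mul, one_mul] at this

/-- The left side is the trace dual of x ↦ tr_E(VxV*), and the conditional expectation is its own
dual. -/
theorem compress_oneTensor (hV : IsStinespringIsometry (condExp N) V) (y : Matrix A A ℂ) :
    Vᴴ * oneTensor E y * V = condExp N y := by
  refine Matrix.ext_iff_trace_mul_left.2 fun x => ?_
  rw [← trace_condExp_mul, hV.2 x, ← trace_mul_oneTensor, Matrix.mul_assoc, Matrix.mul_assoc,
    Matrix.trace_mul_comm x, Matrix.trace_mul_comm (V * x)]
  simp only [Matrix.mul_assoc]

/-- A multiplicative domain argument: the expectation fixes x, x* and x*x, so all terms in the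
square of (1 ⊗ x)V - Vx cancel. -/
theorem oneTensor_mul_isometry (hV : IsStinespringIsometry (condExp N) V) {x : Matrix A A ℂ}
    (hx : x ∈ N) : oneTensor E x * V = V * x := by
  rw [← sub_eq_zero, ← Matrix.conjTranspose_mul_self_eq_zero]
  have hxs : xᴴ ∈ N := star_mem hx
  have h1 := compress_oneTensor hV (xᴴ * x)
  have h2 := compress_oneTensor hV x
  have h3 := compress_oneTensor hV xᴴ
  rw [condExp_of_mem (mul_mem hxs hx), oneTensor_mul] at h1
  rw [condExp_of_mem hx] at h2
  rw [condExp_of_mem hxs] at h3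
  have e : (oneTensor E x * V - V * x)ᴴ * (oneTensor E x * V - V * x) =
      Vᴴ * (oneTensor E xᴴ * oneTensor E x) * V - Vᴴ * oneTensor E xᴴ * V * x -
        xᴴ * (Vᴴ * oneTensor E x * V) + xᴴ * (Vᴴ * V) * x := by
    rw [Matrix.conjTranspose_sub, Matrix.conjTranspose_mul, Matrix.conjTranspose_mul,
      oneTensor_conjTranspose, Matrix.mul_sub, Matrix.sub_mul, Matrix.sub_mul]
    simp only [Matrix.mul_assoc]
    abel
  rw [e, h1, h2, h3, hV.1]
  simp

theorem posSemidef_condExp (hV : IsStinespringIsometry (condExp N) V) {x : Matrix A A ℂ}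
    (hx : x.PosSemidef) : (condExp N x).PosSemidef := by
  rw [← compress_oneTensor hV]
  exact posSemidef_compress (posSemidef_oneTensor hx) V

theorem condExp_mem_stateSpace (hV : IsStinespringIsometry (condExp N) V) {x : Matrix A A ℂ}
    (hx : IsState x) : condExp N x ∈ stateSpace N :=
  ⟨condExp_mem N x, posSemidef_condExp hV hx.1, by rw [trace_condExp, hx.2]⟩

end ConditionalExpectation

/-! ### Divergences under isometries and compressions. -/

section Isometry

open scoped MatrixOrder Matrix.Norms.L2Operator

variable {m n : Type*} [Fintype m] [DecidableEq m] [Fintype n] [DecidableEq n]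
  {V : Matrix m n ℂ}

theorem elog_mono {x y : ℝ} (h : x ≤ y) : elog x ≤ elog y := by
  unfold elog
  split_ifs with hx hy hy
  · exact le_rfl
  · exact bot_le
  · exact absurd (h.trans hy) hx
  · exact EReal.coe_le_coe_iff.2 (Real.logb_le_logb_of_le one_lt_two (not_le.1 hx) h)

theorem coe_mul_elog_mono {c x y : ℝ} (hc : 0 ≤ c) (h : x ≤ y) :
    (c : EReal) * elog x ≤ (c : EReal) * elog y :=
  mul_le_mul_of_nonneg_left (elog_mono h) (EReal.coe_nonneg.2 hc)

theorem coe_mul_elog_anti {c x y : ℝ} (hc : c ≤ 0) (h : x ≤ y) :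
    (c : EReal) * elog y ≤ (c : EReal) * elog x := by
  rw [mul_comm, mul_comm _ (elog x)]
  exact EReal.mul_le_mul_of_nonpos_right (elog_mono h) (EReal.coe_nonpos.2 hc)

theorem posSemidef_conj {X : Matrix n n ℂ} (hX : X.PosSemidef) (V : Matrix m n ℂ) :
    (V * X * Vᴴ).PosSemidef := hX.mul_mul_conjTranspose_same V

theorem matPow_isometry_conj (hV : Vᴴ * V = 1) {X : Matrix n n ℂ} (hX : X.PosSemidef) {p : ℝ}
    (hp : p ≠ 0) : matPow (V * X * Vᴴ) p = V * matPow X p * Vᴴ :=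
  cfc_isometry_conj hV hX.1 (Real.zero_rpow hp)

theorem sandwichTr_isometry (hV : Vᴴ * V = 1) {ρ : Matrix n n ℂ} {σ : Matrix m m ℂ}
    (hρ : ρ.PosSemidef) (hσ : σ.PosSemidef) {α : ℝ} (hα : α ≠ 0) :
    sandwichTr α (V * ρ * Vᴴ) σ = rtr (matPow (matPow ρ (1 / 2) *
      (Vᴴ * matPow σ ((1 - α) / α) * V) * matPow ρ (1 / 2)) α) := by
  rw [sandwichTr_eq (posSemidef_conj hρ V) hσ, matPow_isometry_conj hV hρ (by norm_num)]
  have e : V * matPow ρ (1 / 2) * Vᴴ * matPow σ ((1 - α) / α) * (V * matPow ρ (1 / 2) * Vᴴ) =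
      V * (matPow ρ (1 / 2) * (Vᴴ * matPow σ ((1 - α) / α) * V) * matPow ρ (1 / 2)) * Vᴴ := by
    simp only [Matrix.mul_assoc]
  have h : (matPow ρ (1 / 2) * (Vᴴ * matPow σ ((1 - α) / α) * V) *
      matPow ρ (1 / 2)).PosSemidef := by
    have := posSemidef_compress (posSemidef_compress (posSemidef_matPow hσ ((1 - α) / α)) V)
      (matPow ρ (1 / 2))
    rwa [(posSemidef_matPow hρ _).1.eq] at this
  rw [e, matPow_isometry_conj hV h hα, rtr_isometry_conj hV]

/-- V sends the kernel of V*σV into the kernel of σ, which is orthogonal to the range of VρV*. -/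
theorem suppLE_compress (hV : Vᴴ * V = 1) {ρ : Matrix n n ℂ} {σ : Matrix m m ℂ}
    (hσ : σ.PosSemidef) (h : SuppLE (V * ρ * Vᴴ) σ) : SuppLE ρ (Vᴴ * σ * V) := by
  have hZ := posSemidef_compress hσ V
  have hK := posSemidef_kerProj hZ
  rw [suppLE_iff hσ.1] at h
  rw [suppLE_iff hZ.1]
  have h1 : σ * (V * kerProj (Vᴴ * σ * V)) = 0 := by
    refine mul_eq_zero_of_compress_eq_zero hσ ?_
    rw [Matrix.conjTranspose_mul, hK.1.eq]
    have : kerProj (Vᴴ * σ * V) * Vᴴ * σ * (V * kerProj (Vᴴ * σ * V)) =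
        kerProj (Vᴴ * σ * V) * (Vᴴ * σ * V) * kerProj (Vᴴ * σ * V) := by
      simp only [Matrix.mul_assoc]
    rw [this, kerProj_mul_self hZ.1, Matrix.zero_mul]
  have h2 : kerProj (Vᴴ * σ * V) * Vᴴ * σ = 0 := by
    have := congrArg Matrix.conjTranspose h1
    rwa [Matrix.conjTranspose_mul, Matrix.conjTranspose_mul, hK.1.eq, hσ.1.eq,
      Matrix.conjTranspose_zero] at this
  have h3 : V * ρ * Vᴴ = σ * cfc (fun x : ℝ => x⁻¹) σ * (V * ρ * Vᴴ) := by
    rw [self_mul_pinv hσ.1, Matrix.sub_mul, h, Matrix.one_mul, sub_zero]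
  have h4 : kerProj (Vᴴ * σ * V) * ρ = kerProj (Vᴴ * σ * V) * Vᴴ * (V * ρ * Vᴴ) * V := by
    calc _ = kerProj (Vᴴ * σ * V) * (Vᴴ * V) * ρ * (Vᴴ * V) := by rw [hV]; simp
      _ = _ := by simp only [Matrix.mul_assoc]
  rw [h4, h3, Matrix.mul_assoc σ, ← Matrix.mul_assoc _ σ, h2]
  simp

/-- Compression inequality for negative powers on supports. -/
theorem sqrt_conj_compress_neg (hV : Vᴴ * V = 1) {ρ : Matrix n n ℂ} {σ : Matrix m m ℂ}
    (hρ : ρ.PosSemidef) (hσ : σ.PosSemidef) (h : SuppLE (V * ρ * Vᴴ) σ) {t : ℝ} (h0 : 0 < t)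
    (h1 : t ≤ 1) :
    matPow ρ (1 / 2) * matPow (Vᴴ * σ * V) (-t) * matPow ρ (1 / 2) ≤
      matPow ρ (1 / 2) * (Vᴴ * matPow σ (-t) * V) * matPow ρ (1 / 2) := by
  have hZ := posSemidef_compress hσ V
  have hr := (posSemidef_matPow hρ (1 / 2)).1
  have hkZ := kerProj_mul_sqrt hρ hZ (suppLE_compress hV hσ h)
  have hkσ : kerProj σ * (V * matPow ρ (1 / 2)) = 0 := by
    have := kerProj_mul_sqrt (posSemidef_conj hρ V) hσ h
    rw [matPow_isometry_conj hV hρ (by norm_num)] at this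
    have h2 := congrArg (· * V) this
    simp only [Matrix.zero_mul] at h2
    rwa [Matrix.mul_assoc, Matrix.mul_assoc _ Vᴴ V, hV, Matrix.mul_one] at h2
  set r := matPow ρ (1 / 2)
  set Z := Vᴴ * σ * V
  set R := r * (Vᴴ * matPow σ (-t) * V) * r
  -- The value δ ^ (-t) at 0 blows up as δ → 0, so it is replaced by 0. This costs nothing: it
  -- multiplies kernel projections that annihilate r on the left side and V r on the right.
  have hle : ∀ δ : ℝ, 0 < δ →
      r * cfc (fun x : ℝ => if x = 0 then 0 else (x + δ) ^ (-t)) Z * r ≤ R := by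
    intro δ hδ
    have e1 : r * cfc (fun x : ℝ => if x = 0 then 0 else (x + δ) ^ (-t)) Z * r =
        r * cfc (fun x : ℝ => (x + δ) ^ (-t)) Z * r := by
      have : cfc (fun x : ℝ => (x + δ) ^ (-t)) Z =
          cfc (fun x : ℝ => if x = 0 then 0 else (x + δ) ^ (-t)) Z + δ ^ (-t) • kerProj Z := by
        rw [kerProj, ← cfc_const_mul _ _ _ (continuousOn_spectrum _ _), cfc_add_cfc]
        exact cfc_congr fun x _ => by by_cases hx : x = 0 <;> simp [hx]
      rw [this, mul_add, add_mul, mul_smul_comm, smul_mul_assoc, mul_assoc r (kerProj Z), hkZ]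
      simp
    have e2 := conj_mono (cfc_shift_jensen hV hσ hδ ⟨h0.le, h1⟩) r
    have e3 : cfc (fun x : ℝ => (x + δ) ^ (-t)) σ ≤ matPow σ (-t) + δ ^ (-t) • kerProj σ := by
      rw [kerProj, ← cfc_const_mul _ _ _ (continuousOn_spectrum _ _), matPow, cfc_add_cfc]
      refine cfc_le_cfc fun x hx => ?_
      rcases (spectrum_nonneg hσ hx).eq_or_lt with rfl | hx0
      · simp [Real.zero_rpow (neg_ne_zero.2 h0.ne')]
      · simp only [hx0.ne', if_false, mul_zero, add_zero]
        exact Real.rpow_le_rpow_of_nonpos hx0 (by linarith) (by linarith)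
    have e4 := conj_mono e3 (V * r)
    rw [Matrix.mul_add, Matrix.add_mul, Matrix.mul_smul, Matrix.smul_mul,
      Matrix.mul_assoc _ (kerProj σ), hkσ, Matrix.mul_zero, smul_zero, add_zero,
      Matrix.conjTranspose_mul, hr.eq] at e4
    rw [hr.eq] at e2
    rw [e1]
    refine e2.trans ?_
    simp only [R, Matrix.mul_assoc] at e4 ⊢
    exact e4
  have hlim : Filter.Tendsto (fun δ : ℝ =>
      r * cfc (fun x : ℝ => if x = 0 then 0 else (x + δ) ^ (-t)) Z * r) (𝓝[>] 0)
      (𝓝 (r * matPow Z (-t) * r)) := by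
    refine (Filter.Tendsto.mul tendsto_const_nhds ?_).mul tendsto_const_nhds
    refine tendsto_cfc_of_pointwise hZ.1 fun x _ => ?_
    by_cases hx : x = 0
    · simp only [hx, if_true, Real.zero_rpow (neg_ne_zero.2 h0.ne')]
      exact tendsto_const_nhds
    · simp only [hx, if_false]
      have : ContinuousAt (fun δ : ℝ => (x + δ) ^ (-t)) 0 :=
        ContinuousAt.rpow_const (by fun_prop) (Or.inl (by simpa using hx))
      simpa using this.tendsto.mono_left nhdsWithin_le_nhds
  exact le_of_tendsto hlim (Filter.eventually_of_mem self_mem_nhdsWithin fun δ hδ => hle δ hδ)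

theorem dMax_compress_le (τ σ : Matrix m m ℂ) (V : Matrix m n ℂ) :
    dMax (Vᴴ * τ * V) (Vᴴ * σ * V) ≤ dMax τ σ := by
  refine biInf_mono fun l hl => ⟨hl.1, ?_⟩
  have := posSemidef_compress hl.2 V
  rwa [Matrix.mul_sub, Matrix.sub_mul, Matrix.mul_smul, Matrix.smul_mul] at this

theorem compress_conj (hV : Vᴴ * V = 1) (ρ : Matrix n n ℂ) : Vᴴ * (V * ρ * Vᴴ) * V = ρ := by
  calc _ = (Vᴴ * V) * ρ * (Vᴴ * V) := by simp only [Matrix.mul_assoc]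
    _ = ρ := by rw [hV]; simp

theorem compress_intertwine (hV : Vᴴ * V = 1) {σ : Matrix n n ℂ} {σ' : Matrix m m ℂ}
    (h : σ' * V = V * σ) : Vᴴ * σ' * V = σ := by
  rw [Matrix.mul_assoc, h, ← Matrix.mul_assoc, hV, Matrix.one_mul]

theorem conjTranspose_intertwine {σ : Matrix n n ℂ} {σ' : Matrix m m ℂ} (hσ : σ.IsHermitian)
    (hσ' : σ'.IsHermitian) (h : σ' * V = V * σ) : Vᴴ * σ' = σ * Vᴴ := by
  have := congrArg Matrix.conjTranspose h
  rwa [Matrix.conjTranspose_mul, Matrix.conjTranspose_mul, hσ.eq, hσ'.eq] at this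

theorem dMax_isometry (hV : Vᴴ * V = 1) (ρ : Matrix n n ℂ) {σ : Matrix n n ℂ}
    {σ' : Matrix m m ℂ} (hσ : σ.PosSemidef) (hσ' : σ'.PosSemidef) (h : σ' * V = V * σ) :
    dMax (V * ρ * Vᴴ) σ' = dMax ρ σ := by
  refine le_antisymm ?_ ?_
  · refine biInf_mono fun l hl => ⟨hl.1, ?_⟩
    have h1 := posSemidef_conj hl.2 V
    -- The intertwining makes σ' block diagonal for VV*; adding its positive block off the range of
    -- V recovers the full σ'.
    have h2 := (posSemidef_compress hσ' (1 - V * Vᴴ)).smul (a := (l : ℂ))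
      (by exact_mod_cast hl.1.le)
    have hP : (V * Vᴴ)ᴴ = V * Vᴴ := by simp
    have h3 : V * Vᴴ * σ' = V * σ * Vᴴ := by
      rw [Matrix.mul_assoc, conjTranspose_intertwine hσ.1 hσ'.1 h, Matrix.mul_assoc]
    have h4 : σ' * (V * Vᴴ) = V * σ * Vᴴ := by rw [← Matrix.mul_assoc, h]
    have h5 : V * σ * Vᴴ * (V * Vᴴ) = V * σ * Vᴴ := by
      rw [Matrix.mul_assoc, ← Matrix.mul_assoc Vᴴ, hV, Matrix.one_mul]
    have h6 : (1 - V * Vᴴ)ᴴ * σ' * (1 - V * Vᴴ) = σ' - V * σ * Vᴴ := by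
      rw [Matrix.conjTranspose_sub, hP, Matrix.conjTranspose_one, Matrix.sub_mul, Matrix.one_mul,
        h3, Matrix.mul_sub, Matrix.mul_one, Matrix.sub_mul, h4, h5]
      simp
    rw [h6] at h2
    have h7 := h2.add h1
    rw [Matrix.mul_sub, Matrix.sub_mul, Matrix.mul_smul, Matrix.smul_mul, smul_sub] at h7
    convert h7 using 1
    abel
  · have := dMax_compress_le (V * ρ * Vᴴ) σ' V
    rwa [compress_conj hV, compress_intertwine hV h] at this

theorem suppLE_isometry_iff (hV : Vᴴ * V = 1) {ρ σ : Matrix n n ℂ} {σ' : Matrix m m ℂ}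
    (hσ : σ.PosSemidef) (hσ' : σ'.PosSemidef) (h : σ' * V = V * σ) :
    SuppLE (V * ρ * Vᴴ) σ' ↔ SuppLE ρ σ := by
  rw [suppLE_iff hσ'.1, suppLE_iff hσ.1, ← Matrix.mul_assoc, ← Matrix.mul_assoc,
    show kerProj σ' * V = V * kerProj σ from cfc_intertwine hσ'.1 hσ.1 h _]
  constructor
  · intro h1
    have h2 := congrArg (fun X => Vᴴ * X * V) h1
    simp only [Matrix.mul_zero, Matrix.zero_mul] at h2
    rwa [Matrix.mul_assoc V, compress_conj hV] at h2
  · intro h1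
    rw [Matrix.mul_assoc V, h1]; simp

theorem relEnt_isometry (hV : Vᴴ * V = 1) {ρ σ : Matrix n n ℂ} {σ' : Matrix m m ℂ}
    (hρ : ρ.PosSemidef) (hσ : σ.PosSemidef) (hσ' : σ'.PosSemidef) (h : σ' * V = V * σ) :
    relEnt (V * ρ * Vᴴ) σ' = relEnt ρ σ := by
  have h1 : matLog (V * ρ * Vᴴ) = V * matLog ρ * Vᴴ := cfc_isometry_conj hV hρ.1 (by simp)
  have h2 : matLog σ' * V = V * matLog σ := cfc_intertwine hσ'.1 hσ.1 h _
  have h3 : Vᴴ * matLog σ' = matLog σ * Vᴴ :=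
    conjTranspose_intertwine (isHermitian_cfc _ _) (isHermitian_cfc _ _) h2
  have h4 : V * ρ * Vᴴ * (V * matLog ρ * Vᴴ) = V * (ρ * matLog ρ) * Vᴴ := by
    calc _ = V * ρ * (Vᴴ * V) * matLog ρ * Vᴴ := by simp only [Matrix.mul_assoc]
      _ = _ := by rw [hV]; simp only [Matrix.mul_one, Matrix.mul_assoc]
  have h5 : V * ρ * Vᴴ * matLog σ' = V * (ρ * matLog σ) * Vᴴ := by
    rw [Matrix.mul_assoc, h3]; simp only [Matrix.mul_assoc]
  rw [relEnt, relEnt, h1, h4, h5, ← Matrix.sub_mul, ← Matrix.mul_sub, rtr_isometry_conj hV]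
  have h6 := suppLE_isometry_iff hV (ρ := ρ) hσ hσ' h
  by_cases h7 : SuppLE ρ σ
  · rw [if_pos (h6.2 h7), if_pos h7]
  · rw [if_neg (fun h8 => h7 (h6.1 h8)), if_neg h7]

theorem dAlpha_isometry (hV : Vᴴ * V = 1) {ρ σ : Matrix n n ℂ} {σ' : Matrix m m ℂ}
    (hρ : ρ.PosSemidef) (hσ : σ.PosSemidef) (hσ' : σ'.PosSemidef) (h : σ' * V = V * σ)
    {α : ℝ≥0∞} (hα : α ≠ 0) :
    dAlpha α (V * ρ * Vᴴ) σ' = dAlpha α ρ σ := by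
  unfold dAlpha
  split_ifs with h1 h2 h3 h4 h4
  · exact dMax_isometry hV ρ hσ hσ' h
  · exact relEnt_isometry hV hρ hσ hσ' h
  · rfl
  · exact absurd ⟨h3.1, fun h5 => h3.2 ((suppLE_isometry_iff hV hσ hσ' h).2 h5)⟩ h4
  · exact absurd ⟨h4.1, fun h5 => h4.2 ((suppLE_isometry_iff hV hσ hσ' h).1 h5)⟩ h3
  · rw [sandwichTr_isometry hV hρ hσ' (ENNReal.toReal_ne_zero.2 ⟨hα, h1⟩), sandwichTr_eq hρ hσ,
      show Vᴴ * matPow σ' ((1 - α.toReal) / α.toReal) * V = matPow σ ((1 - α.toReal) / α.toReal)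
      from compress_intertwine hV (cfc_intertwine hσ'.1 hσ.1 h _)]

/-- Data processing of the sandwiched Rényi divergences under compression by an isometry whose
range supports the first argument. -/
theorem dAlpha_compress_le (hV : Vᴴ * V = 1) {ρ : Matrix n n ℂ} {σ : Matrix m m ℂ}
    (hρ : ρ.PosSemidef) (hσ : σ.PosSemidef) {α : ℝ≥0∞} (hα : 1 / 2 ≤ α) (h1 : α ≠ 1) :
    dAlpha α ρ (Vᴴ * σ * V) ≤ dAlpha α (V * ρ * Vᴴ) σ := by
  have hZ := posSemidef_compress hσ V
  have hr := (posSemidef_matPow hρ (1 / 2)).1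
  by_cases htop : α = ⊤
  · simp only [dAlpha, htop, if_true]
    have := dMax_compress_le (V * ρ * Vᴴ) σ V
    rwa [compress_conj hV] at this
  have hα' : 1 / 2 ≤ α.toReal := by
    have := ENNReal.toReal_mono htop hα
    simpa using this
  simp only [dAlpha, htop, h1, if_false]
  by_cases h2 : 1 < α ∧ ¬ SuppLE (V * ρ * Vᴴ) σ
  · rw [if_pos h2]; exact le_top
  rw [if_neg h2]
  have h3 : ¬ (1 < α ∧ ¬ SuppLE ρ (Vᴴ * σ * V)) := fun h3 =>
    h2 ⟨h3.1, fun h4 => h3.2 (suppLE_compress hV hσ h4)⟩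
  rw [if_neg h3, sandwichTr_eq hρ hZ, sandwichTr_isometry hV hρ hσ (by linarith)]
  -- For α < 1 the exponent (1-α)/α is in [0, 1], so compressing σ first enlarges the trace, and the
  -- prefactor 1/(α-1) is negative. For α > 1 the exponent is in (-1, 0), the trace shrinks, and the
  -- prefactor is positive.
  rcases lt_or_gt_of_ne h1 with hlt | hgt
  · have hlt' : α.toReal < 1 := by
      have := (ENNReal.toReal_lt_toReal htop ENNReal.one_ne_top).2 hlt
      simpa using this
    refine coe_mul_elog_anti (by rw [one_div, inv_nonpos]; linarith) ?_
    have hJ := conj_mono (matPow_jensen hV hσ (p := (1 - α.toReal) / α.toReal)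
      ⟨div_nonneg (by linarith) (by linarith), by rw [div_le_one (by linarith)]; linarith⟩)
      (matPow ρ (1 / 2))
    have hp := posSemidef_compress (posSemidef_compress (posSemidef_matPow hσ
      ((1 - α.toReal) / α.toReal)) V) (matPow ρ (1 / 2))
    rw [hr.eq] at hJ hp
    exact rtr_matPow_mono hp hJ (by linarith)
  · have hgt' : 1 < α.toReal := by
      have := (ENNReal.toReal_lt_toReal ENNReal.one_ne_top htop).2 hgt
      simpa using this
    refine coe_mul_elog_mono (by rw [one_div, inv_nonneg]; linarith) ?_
    have hJ := sqrt_conj_compress_neg hV hρ hσ (by_contra fun h4 => h2 ⟨hgt, h4⟩)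
      (t := (α.toReal - 1) / α.toReal) (div_pos (by linarith) (by linarith))
      (by rw [div_le_one (by linarith)]; linarith)
    rw [← neg_div, neg_sub] at hJ
    have hp := posSemidef_compress (posSemidef_matPow hZ ((1 - α.toReal) / α.toReal))
      (matPow ρ (1 / 2))
    rw [hr.eq] at hp
    exact rtr_matPow_mono hp hJ (by linarith)

end Isometry

/-! ### Gibbs' inequality and the cases α = 1 and α = 1/2. -/

section RelativeEntropy

variable {n A E : Type*} [Fintype n] [DecidableEq n] [Fintype A] [DecidableEq A] [Fintype E]
  [DecidableEq E]

theorem sub_le_mul_log_sub {a s : ℝ} (ha : 0 ≤ a) (hs : 0 < s) :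
    a - s ≤ a * Real.log a - a * Real.log s := by
  rcases ha.eq_or_lt with rfl | ha
  · simp [hs.le]
  · have h := Real.log_le_sub_one_of_pos (div_pos hs ha)
    rw [Real.log_div hs.ne' ha.ne'] at h
    have h2 := mul_le_mul_of_nonneg_left h ha.le
    have h3 : a * (s / a - 1) = s - a := by field_simp
    rw [h3] at h2
    linarith

theorem IsState.rtr_eq_one {ρ : Matrix n n ℂ} (h : IsState ρ) : rtr ρ = 1 := by
  rw [rtr, h.2]; rfl

theorem mul_matLog_eq {X : Matrix n n ℂ} (hX : X.IsHermitian) :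
    X * matLog X = cfc (fun x => x * Real.logb 2 x) X := by
  conv_lhs => enter [1]; rw [← cfc_self hX]
  rw [matLog, cfc_mul_cfc]

/-- Gibbs' inequality. -/
theorem rtr_mul_matLog_le {ρ σ : Matrix n n ℂ} (hρ : IsState ρ) (hσ : IsState σ)
    (h : SuppLE ρ σ) : rtr (ρ * matLog σ) ≤ rtr (ρ * matLog ρ) := by
  obtain ⟨w, hw, hfg, hz⟩ := exists_spectral_weights_of_suppLE hρ.1 hσ.1 h
  have hl2 : 0 < Real.log 2 := Real.log_pos one_lt_two
  have e2 := hfg (fun x => x) (fun x => Real.logb 2 x)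
  have e3 := hfg (fun x => x * Real.logb 2 x) (fun _ => 1)
  have e4 := hfg (fun x => x) (fun _ => 1)
  have e5 := hfg (fun _ => 1) (fun x => x)
  rw [cfc_self hρ.1.1] at e2 e4
  rw [cfc_const_eq hσ.1.1, one_smul, mul_one] at e3 e4
  rw [cfc_const_eq hρ.1.1, one_smul, one_mul, cfc_self hσ.1.1] at e5
  rw [hρ.rtr_eq_one] at e4
  rw [hσ.rtr_eq_one] at e5
  have ha := hρ.1.eigenvalues_nonneg
  rw [mul_matLog_eq hρ.1.1, e3, show rtr (ρ * matLog σ) = _ from e2]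
  -- The left side is (tr ρ - tr σ) / ln 2 = 0; termwise, the inequality is a - s ≤ a ln a - a ln s.
  have key : ∑ i, ∑ j, w i j * (hρ.1.1.eigenvalues i * 1) / Real.log 2 -
      ∑ i, ∑ j, w i j * (1 * hσ.1.1.eigenvalues j) / Real.log 2 ≤
      ∑ i, ∑ j, w i j * (hρ.1.1.eigenvalues i * Real.logb 2 (hρ.1.1.eigenvalues i) * 1) -
      ∑ i, ∑ j, w i j * (hρ.1.1.eigenvalues i * Real.logb 2 (hσ.1.1.eigenvalues j)) := by
    rw [← Finset.sum_sub_distrib, ← Finset.sum_sub_distrib]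
    refine Finset.sum_le_sum fun i _ => ?_
    rw [← Finset.sum_sub_distrib, ← Finset.sum_sub_distrib]
    refine Finset.sum_le_sum fun j _ => ?_
    rcases hz i j with h0 | h0 | h0
    · have h8 := mul_le_mul_of_nonneg_left (sub_le_mul_log_sub (ha i) h0) (hw i j)
      rw [Real.logb, Real.logb, ← sub_div]
      have h9 := div_le_div_of_nonneg_right h8 hl2.le
      calc _ = _ := by ring
        _ ≤ _ := h9
        _ = _ := by ring
    · simp [h0]
    · have := mul_nonneg (hw i j) (hσ.1.eigenvalues_nonneg j)
      simp only [h0, zero_mul, mul_zero, zero_div, sub_zero, one_mul, zero_sub,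
        Left.neg_nonpos_iff]
      positivity
  simp only [← Finset.sum_div, ← e4, ← e5, sub_self] at key
  linarith

theorem relEnt_oneTensor_ptraceE {τ : Matrix (E × A) (E × A) ℂ} (hτ : τ.PosSemidef) :
    relEnt τ (oneTensor E (ptraceE τ)) = -((condEntropy τ : ℝ) : EReal) := by
  have hA := posSemidef_ptraceE hτ
  rw [relEnt, if_pos ((suppLE_oneTensor_iff hτ hA).2 (suppLE_refl _)), matLog_oneTensor hA.1,
    rtr_sub, rtr_mul_oneTensor, ← EReal.coe_neg, condEntropy, vnEntropy, vnEntropy]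
  congr 1
  ring

/-- σ enters only through tr(τ_A log σ), which Gibbs' inequality maximises at σ = τ_A. -/
theorem relEnt_oneTensor_le {τ : Matrix (E × A) (E × A) ℂ} (hτ : IsState τ) {σ : Matrix A A ℂ}
    (hσ : IsState σ) : relEnt τ (oneTensor E (ptraceE τ)) ≤ relEnt τ (oneTensor E σ) := by
  have hA := isState_ptraceE hτ
  by_cases h : SuppLE τ (oneTensor E σ)
  · rw [relEnt, relEnt, if_pos h, if_pos ((suppLE_oneTensor_iff hτ.1 hA.1).2 (suppLE_refl _)),
      EReal.coe_le_coe_iff, matLog_oneTensor hA.1.1, matLog_oneTensor hσ.1.1, rtr_sub, rtr_sub,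
      rtr_mul_oneTensor, rtr_mul_oneTensor]
    have := rtr_mul_matLog_le hA hσ ((suppLE_oneTensor_iff hτ.1 hσ.1).1 h)
    linarith
  · rw [relEnt.eq_1 τ (oneTensor E σ), if_neg h]
    exact le_top

theorem dAlpha_one (ρ σ : Matrix n n ℂ) : dAlpha 1 ρ σ = relEnt ρ σ := by simp [dAlpha]

theorem dAlpha_half {ρ σ : Matrix n n ℂ} (hρ : ρ.PosSemidef) (hσ : σ.PosSemidef) :
    dAlpha (1 / 2) ρ σ = dMin ρ σ := by
  have h1 : ((1 : ℝ≥0∞) / 2) ≠ ⊤ := by simp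
  have h2 : ((1 : ℝ≥0∞) / 2) < 1 := by
    rw [one_div]; exact ENNReal.inv_lt_one.2 ENNReal.one_lt_two
  have h3 : ((1 : ℝ≥0∞) / 2).toReal = 1 / 2 := by simp
  rw [dAlpha, if_neg h1, if_neg h2.ne, if_neg (fun h => absurd h.1 (not_lt.2 h2.le)), h3, dMin,
    trNorm, sandwichTr, Matrix.conjTranspose_mul, (posSemidef_matPow hρ _).1.eq,
    (posSemidef_matPow hσ _).1.eq]
  have e : matPow σ ((1 - 1 / 2) / (2 * (1 / 2))) * ρ * matPow σ ((1 - 1 / 2) / (2 * (1 / 2))) =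
      matPow σ (1 / 2) * matPow ρ (1 / 2) * (matPow ρ (1 / 2) * matPow σ (1 / 2)) := by
    conv_lhs => rw [← sqrt_mul_sqrt hρ]
    norm_num
    simp only [mul_assoc]
  rw [e]
  norm_num

end RelativeEntropy

/-! ### Unsmoothed divergences relative to N. -/

section SubalgebraDivergence

variable {A E : Type*} [Fintype A] [DecidableEq A] [Fintype E] [DecidableEq E]
  {N : StarSubalgebra ℂ (Matrix A A ℂ)} {V : Matrix (E × A) A ℂ}

theorem isState_conj {m n : Type*} [Fintype m] [DecidableEq m] [Fintype n] [DecidableEq n]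
    {V : Matrix m n ℂ} (hV : Vᴴ * V = 1) {ρ : Matrix n n ℂ} (hρ : IsState ρ) :
    IsState (V * ρ * Vᴴ) :=
  ⟨posSemidef_conj hρ.1 V, by
    rw [Matrix.trace_mul_comm, ← Matrix.mul_assoc, hV, Matrix.one_mul, hρ.2]⟩

theorem dAlpha_conj_oneTensor (hV : IsStinespringIsometry (condExp N) V) {ρ σ : Matrix A A ℂ}
    (hρ : ρ.PosSemidef) (hσN : σ ∈ N) (hσ : σ.PosSemidef) {α : ℝ≥0∞} (hα : α ≠ 0) :
    dAlpha α (V * ρ * Vᴴ) (oneTensor E σ) = dAlpha α ρ σ :=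
  dAlpha_isometry hV.1 hρ hσ (posSemidef_oneTensor hσ) (oneTensor_mul_isometry hV hσN) hα

/-- Each σ is beaten by its expectation, and states of N keep their value. No normalisation of ρ is
imposed, because α = 1/2 is later applied to substates of a smoothing ball. -/
theorem dAlphaAlg_eq_of_ne_one (hV : IsStinespringIsometry (condExp N) V) {ρ : Matrix A A ℂ}
    (hρ : ρ.PosSemidef) {α : ℝ≥0∞} (hα : 1 / 2 ≤ α) (h1 : α ≠ 1) :
    dAlphaAlg α ρ N = ⨅ σ ∈ {σ : Matrix A A ℂ | IsState σ},
      dAlpha α (V * ρ * Vᴴ) (oneTensor E σ) := by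
  have hα0 : α ≠ 0 := fun h => by simp [h] at hα
  refine le_antisymm (le_iInf₂ fun σ hσ => ?_) (le_iInf₂ fun σ hσ => ?_)
  · refine (iInf₂_le (condExp N σ) (condExp_mem_stateSpace hV hσ)).trans ?_
    rw [← compress_oneTensor hV]
    exact dAlpha_compress_le hV.1 hρ (posSemidef_oneTensor hσ.1) hα h1
  · rw [← dAlpha_conj_oneTensor hV hρ hσ.1 hσ.2.1 hα0]
    exact iInf₂_le σ hσ.2

/-- The unrestricted minimiser tr_E(VρV*) is the expectation of ρ, hence already in N, so both
infima are attained there. -/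
theorem dAlphaAlg_one (hV : IsStinespringIsometry (condExp N) V) {ρ : Matrix A A ℂ}
    (hρ : IsState ρ) : dAlphaAlg 1 ρ N = -((condEntropy (V * ρ * Vᴴ) : ℝ) : EReal) ∧
      (⨅ σ ∈ {σ : Matrix A A ℂ | IsState σ}, dAlpha 1 (V * ρ * Vᴴ) (oneTensor E σ)) =
        -((condEntropy (V * ρ * Vᴴ) : ℝ) : EReal) := by
  have hτ := isState_conj hV.1 hρ
  have hmem : ptraceE (V * ρ * Vᴴ) ∈ stateSpace N := by
    rw [← hV.2]; exact condExp_mem_stateSpace hV hρ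
  have hle : ∀ σ, IsState σ → -((condEntropy (V * ρ * Vᴴ) : ℝ) : EReal) ≤
      dAlpha 1 (V * ρ * Vᴴ) (oneTensor E σ) := fun σ hσ => by
    rw [← relEnt_oneTensor_ptraceE hτ.1, dAlpha_one]
    exact relEnt_oneTensor_le hτ hσ
  constructor
  · refine le_antisymm ((iInf₂_le _ hmem).trans ?_) (le_iInf₂ fun σ hσ => ?_)
    · rw [← dAlpha_conj_oneTensor hV hρ.1 hmem.1 hmem.2.1 one_ne_zero, dAlpha_one,
        relEnt_oneTensor_ptraceE hτ.1]
    · rw [← dAlpha_conj_oneTensor hV hρ.1 hσ.1 hσ.2.1 one_ne_zero]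
      exact hle σ hσ.2
  · refine le_antisymm ((iInf₂_le _ hmem.2).trans ?_) (le_iInf₂ fun σ hσ => hle σ hσ)
    rw [dAlpha_one, relEnt_oneTensor_ptraceE hτ.1]

theorem dAlphaAlg_eq (hV : IsStinespringIsometry (condExp N) V) {ρ : Matrix A A ℂ}
    (hρ : IsState ρ) {α : ℝ≥0∞} (hα : 1 / 2 ≤ α) :
    dAlphaAlg α ρ N = ⨅ σ ∈ {σ : Matrix A A ℂ | IsState σ},
      dAlpha α (V * ρ * Vᴴ) (oneTensor E σ) := by
  rcases eq_or_ne α 1 with rfl | h1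
  · rw [(dAlphaAlg_one hV hρ).1, (dAlphaAlg_one hV hρ).2]
  · exact dAlphaAlg_eq_of_ne_one hV hρ.1 hα h1

theorem EReal.neg_biSup_neg {ι : Type*} (s : Set ι) (f : ι → EReal) :
    -(⨆ i ∈ s, -f i) = ⨅ i ∈ s, f i := by
  refine le_antisymm (le_iInf₂ fun i hi => ?_) ?_
  · rw [EReal.neg_le]
    exact le_iSup₂ (f := fun i (_ : i ∈ s) => -f i) i hi
  · rw [EReal.le_neg]
    refine iSup₂_le fun i hi => ?_
    rw [EReal.neg_le_neg_iff]
    exact iInf₂_le i hi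

theorem dAlphaAlg_eq_neg_hAlpha (hV : IsStinespringIsometry (condExp N) V) {ρ : Matrix A A ℂ}
    (hρ : IsState ρ) {α : ℝ≥0∞} (hα : 1 / 2 ≤ α) :
    dAlphaAlg α ρ N = -hAlpha α (V * ρ * Vᴴ) := by
  rcases eq_or_ne α 1 with rfl | h1
  · rw [(dAlphaAlg_one hV hρ).1, hAlpha, if_pos rfl]
  · rw [dAlphaAlg_eq hV hρ hα, hAlpha, if_neg h1, EReal.neg_biSup_neg]

end SubalgebraDivergence

/-! ### Trace norm, fidelity and smoothing balls. -/

section TraceNorm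

open scoped MatrixOrder

variable {m n : Type*} [Fintype m] [DecidableEq m] [Fintype n] [DecidableEq n]

theorem le_one_of_isIdempotent {P : Matrix n n ℂ} (hP : P.IsHermitian) (h : P * P = P) :
    P ≤ 1 := by
  rw [Matrix.le_iff]
  have h1 := Matrix.posSemidef_conjTranspose_mul_self (1 - P)
  have h2 : (1 - P)ᴴ * (1 - P) = 1 - P := by
    rw [Matrix.conjTranspose_sub, hP.eq, Matrix.conjTranspose_one, sub_mul, mul_sub, mul_sub, h]
    simp
  rwa [h2] at h1

theorem one_sub_kerProj_le_one {σ : Matrix n n ℂ} (hσ : σ.PosSemidef) : 1 - kerProj σ ≤ 1 :=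
  sub_le_self _ (posSemidef_kerProj hσ).nonneg

theorem trNorm_nonneg (Y : Matrix n n ℂ) : 0 ≤ trNorm Y :=
  rtr_nonneg (posSemidef_matPow (Matrix.posSemidef_conjTranspose_mul_self Y) _)

theorem trNorm_conjTranspose (Y : Matrix n n ℂ) : trNorm Yᴴ = trNorm Y := by
  rw [trNorm, Matrix.conjTranspose_conjTranspose]
  exact (rtr_cfc_conjTranspose_mul _ Y).symm

/-- Expand tr(H(1 - C)*(1 - C)) ≥ 0 and bound C*C by 1. -/
theorem rtr_contraction_mul_le {C H : Matrix n n ℂ} (hH : H.PosSemidef) (hC : Cᴴ * C ≤ 1) :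
    rtr (C * H) ≤ rtr H := by
  have h1 := rtr_mul_nonneg hH (Matrix.posSemidef_conjTranspose_mul_self (1 - C))
  have h2 := rtr_mul_mono hH hC
  have h3 : H * ((1 - C)ᴴ * (1 - C)) = H - H * C - H * Cᴴ + H * (Cᴴ * C) := by
    rw [Matrix.conjTranspose_sub, Matrix.conjTranspose_one]; noncomm_ring
  have h4 : rtr (H * Cᴴ) = rtr (C * H) := by
    rw [← rtr_conjTranspose, Matrix.conjTranspose_mul, Matrix.conjTranspose_conjTranspose, hH.1.eq]
  rw [h3, rtr_add, rtr_sub, rtr_sub, h4, rtr_mul_comm H C] at h1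
  rw [mul_one] at h2
  linarith

/-- Polar decomposition. -/
theorem exists_polar (Y : Matrix n n ℂ) : ∃ U : Matrix n n ℂ, Uᴴ * U ≤ 1 ∧ U * Uᴴ ≤ 1 ∧
    Y = U * matPow (Yᴴ * Y) (1 / 2) ∧ Uᴴ * Y = matPow (Yᴴ * Y) (1 / 2) := by
  have hM := Matrix.posSemidef_conjTranspose_mul_self Y
  set M := Yᴴ * Y with hMdef
  -- J is the inverse of |Y| on its support, so YJ is the partial isometry of the polar
  -- decomposition.
  set J := matPow M (-(1 / 2)) with hJ
  have hJh : Jᴴ = J := (posSemidef_matPow hM _).1.eq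
  have hJM : J * matPow M (1 / 2) = 1 - kerProj M := by
    rw [hJ, matPow, matPow, cfc_mul_cfc, kerProj, ← cfc_one ℝ M hM.1.isSelfAdjoint, cfc_sub_cfc]
    refine cfc_congr_nonneg hM fun x hx => ?_
    rcases hx.eq_or_lt with rfl | hx
    · simp
    · rw [← Real.rpow_add hx]; simp [hx.ne']
  have hJK : J * kerProj M = 0 := by
    rw [hJ, matPow, kerProj, cfc_mul_cfc, ← cfc_const_zero ℝ M]
    refine cfc_congr fun x _ => ?_
    by_cases h : x = 0 <;> simp [h]
  have hYK : Y * kerProj M = 0 := by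
    rw [← Matrix.conjTranspose_mul_self_eq_zero, Matrix.conjTranspose_mul,
      (posSemidef_kerProj hM).1.eq, mul_assoc, ← mul_assoc Yᴴ, ← hMdef, ← mul_assoc,
      kerProj_mul_self hM.1, zero_mul]
  have hJMM : J * M = matPow M (1 / 2) := by
    conv_lhs => enter [2]; rw [← matPow_one hM]
    rw [hJ, matPow, matPow, cfc_mul_cfc]
    refine cfc_congr_nonneg hM fun x hx => ?_
    rcases hx.eq_or_lt with rfl | hx
    · simp
    · rw [← Real.rpow_add hx]; norm_num
  have hUY : (Y * J)ᴴ * Y = matPow M (1 / 2) := by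
    rw [Matrix.conjTranspose_mul, hJh, mul_assoc, ← hMdef, hJMM]
  have hUU : (Y * J)ᴴ * (Y * J) = 1 - kerProj M := by
    rw [← mul_assoc, hUY, ← hJM, hJ, matPow, matPow, cfc_mul_cfc, cfc_mul_cfc]
    exact cfc_congr fun x _ => mul_comm _ _
  refine ⟨Y * J, ?_, ?_, ?_, hUY⟩
  · rw [hUU]; exact one_sub_kerProj_le_one hM
  · refine le_one_of_isIdempotent (Matrix.isHermitian_mul_conjTranspose_self _) ?_
    have hYJ : Y * J * kerProj M = 0 := by rw [mul_assoc, hJK, mul_zero]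
    rw [mul_assoc (Y * J), ← mul_assoc (Y * J)ᴴ, hUU, sub_mul, one_mul, mul_sub,
      ← mul_assoc _ (kerProj M), hYJ, zero_mul, sub_zero]
  · rw [mul_assoc, hJM, mul_sub, hYK, mul_one, sub_zero]

theorem rtr_mul_le_trNorm {W : Matrix n n ℂ} (hW : Wᴴ * W ≤ 1) (Y : Matrix n n ℂ) :
    rtr (W * Y) ≤ trNorm Y := by
  obtain ⟨U, hU, -, hY, -⟩ := exists_polar Y
  conv_lhs => rw [hY]
  rw [← mul_assoc]
  refine rtr_contraction_mul_le
    (posSemidef_matPow (Matrix.posSemidef_conjTranspose_mul_self Y) _) ?_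
  have h := conj_mono hW U
  rw [mul_one] at h
  rw [Matrix.conjTranspose_mul, mul_assoc, ← mul_assoc Wᴴ, ← mul_assoc]
  exact h.trans hU

/-- With `rtr_mul_le_trNorm`, this makes the trace norm a maximum of linear functionals; convexity
follows, and maximisers supply amplitudes. -/
theorem exists_contraction_rtr_eq (Y : Matrix n n ℂ) : ∃ W : Matrix n n ℂ, Wᴴ * W ≤ 1 ∧
    W * Wᴴ ≤ 1 ∧ rtr (W * Y) = trNorm Y := by
  obtain ⟨U, h1, h2, -, h3⟩ := exists_polar Y
  exact ⟨Uᴴ, by simpa using h2, by simpa using h1, by rw [h3, trNorm]⟩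

theorem trNorm_convex (Y Z : Matrix n n ℂ) {a b : ℝ} (ha : 0 ≤ a) (hb : 0 ≤ b) :
    trNorm (a • Y + b • Z) ≤ a * trNorm Y + b * trNorm Z := by
  obtain ⟨W, h1, -, h3⟩ := exists_contraction_rtr_eq (a • Y + b • Z)
  rw [← h3, mul_add, mul_smul_comm, mul_smul_comm, rtr_add, rtr_smul, rtr_smul]
  exact add_le_add (mul_le_mul_of_nonneg_left (rtr_mul_le_trNorm h1 Y) ha)
    (mul_le_mul_of_nonneg_left (rtr_mul_le_trNorm h1 Z) hb)

theorem trNorm_sqrt_mul {σ : Matrix n n ℂ} (hσ : σ.PosSemidef) (X : Matrix n n ℂ) :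
    trNorm (matPow σ (1 / 2) * X) = rtr (matPow (Xᴴ * σ * X) (1 / 2)) := by
  rw [trNorm, Matrix.conjTranspose_mul, (posSemidef_matPow hσ _).1.eq, mul_assoc,
    ← mul_assoc _ _ X, sqrt_mul_sqrt hσ, ← mul_assoc]

/-- The fidelity `tr |√ρ √σ|` without the correction for subnormalisation. -/
noncomputable def rootFidelity (ρ σ : Matrix n n ℂ) : ℝ :=
  trNorm (matPow ρ (1 / 2) * matPow σ (1 / 2))

theorem rootFidelity_eq {ρ σ : Matrix n n ℂ} (hρ : ρ.PosSemidef) (hσ : σ.PosSemidef) :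
    rootFidelity ρ σ =
      rtr (matPow (matPow σ (1 / 2) * ρ * matPow σ (1 / 2)) (1 / 2)) := by
  rw [rootFidelity, trNorm_sqrt_mul hρ, (posSemidef_matPow hσ _).1.eq]

theorem rootFidelity_comm {ρ σ : Matrix n n ℂ} (hρ : ρ.PosSemidef) (hσ : σ.PosSemidef) :
    rootFidelity ρ σ = rootFidelity σ ρ := by
  rw [rootFidelity, rootFidelity, ← trNorm_conjTranspose, Matrix.conjTranspose_mul,
    (posSemidef_matPow hσ _).1.eq, (posSemidef_matPow hρ _).1.eq]

/-- Any factor X of a state can replace its square root in the fidelity. The argument of the trace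
norm becomes linear in X, which is what yields convexity for the minimax. -/
theorem rootFidelity_mul_conjTranspose (X : Matrix n n ℂ) {σ : Matrix n n ℂ}
    (hσ : σ.PosSemidef) : rootFidelity (X * Xᴴ) σ = trNorm (matPow σ (1 / 2) * X) := by
  have hs := (posSemidef_matPow hσ (1 / 2)).1.eq
  rw [rootFidelity_eq (Matrix.posSemidef_self_mul_conjTranspose X) hσ, ← trNorm_conjTranspose,
    trNorm, Matrix.conjTranspose_conjTranspose, Matrix.conjTranspose_mul, hs]
  simp only [mul_assoc]

theorem rootFidelity_mono_left {ρ ρ' σ : Matrix n n ℂ} (hρ : ρ.PosSemidef) (h : ρ ≤ ρ')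
    (hσ : σ.PosSemidef) : rootFidelity ρ σ ≤ rootFidelity ρ' σ := by
  have hρ' : ρ'.PosSemidef := Matrix.nonneg_iff_posSemidef.1 (hρ.nonneg.trans h)
  have hs := (posSemidef_matPow hσ (1 / 2)).1.eq
  rw [rootFidelity_eq hρ hσ, rootFidelity_eq hρ' hσ]
  have h1 := conj_mono h (matPow σ (1 / 2))
  have h2 := posSemidef_compress hρ (matPow σ (1 / 2))
  rw [hs] at h1 h2
  exact rtr_matPow_mono h2 h1 (by norm_num)

theorem rootFidelity_isometry_right {V : Matrix m n ℂ} (hV : Vᴴ * V = 1) {τ : Matrix m m ℂ}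
    {ρ : Matrix n n ℂ} (hτ : τ.PosSemidef) (hρ : ρ.PosSemidef) :
    rootFidelity τ (V * ρ * Vᴴ) = rootFidelity (Vᴴ * τ * V) ρ := by
  have hs := (posSemidef_matPow hρ (1 / 2)).1.eq
  rw [rootFidelity_eq hτ (posSemidef_conj hρ V), rootFidelity_eq (posSemidef_compress hτ V) hρ,
    matPow_isometry_conj hV hρ (by norm_num)]
  have h := posSemidef_compress (posSemidef_compress hτ V) (matPow ρ (1 / 2))
  rw [hs] at h
  have e : V * matPow ρ (1 / 2) * Vᴴ * τ * (V * matPow ρ (1 / 2) * Vᴴ) =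
      V * (matPow ρ (1 / 2) * (Vᴴ * τ * V) * matPow ρ (1 / 2)) * Vᴴ := by
    simp only [Matrix.mul_assoc]
  rw [e, matPow_isometry_conj hV h (by norm_num), rtr_isometry_conj hV]

theorem isometry_mul_conjTranspose_le {V : Matrix m n ℂ} (hV : Vᴴ * V = 1) : V * Vᴴ ≤ 1 :=
  le_one_of_isIdempotent (Matrix.isHermitian_mul_conjTranspose_self V) (by
    rw [Matrix.mul_assoc, ← Matrix.mul_assoc Vᴴ, hV, Matrix.one_mul])

/-- Compressing by an isometry that intertwines the second arguments decreases the fidelity. -/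
theorem rootFidelity_compress_le {V : Matrix m n ℂ} (hV : Vᴴ * V = 1) {τ σ' : Matrix m m ℂ}
    {σ : Matrix n n ℂ} (hτ : τ.PosSemidef) (hσ' : σ'.PosSemidef) (hσ : σ.PosSemidef)
    (h : σ' * V = V * σ) : rootFidelity (Vᴴ * τ * V) σ ≤ rootFidelity τ σ' := by
  have hs := (posSemidef_matPow hσ (1 / 2)).1
  have hs' := (posSemidef_matPow hσ' (1 / 2)).1
  have h1 : matPow σ' (1 / 2) * V = V * matPow σ (1 / 2) := cfc_intertwine hσ'.1 hσ.1 h _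
  have h2 := conjTranspose_intertwine hs hs' h1
  have hX := posSemidef_compress hτ (matPow σ' (1 / 2))
  rw [hs'.eq] at hX
  rw [rootFidelity_eq (posSemidef_compress hτ V) hσ, rootFidelity_eq hτ hσ']
  set X := matPow σ' (1 / 2) * τ * matPow σ' (1 / 2) with hXdef
  have e : matPow σ (1 / 2) * (Vᴴ * τ * V) * matPow σ (1 / 2) = Vᴴ * X * V := by
    calc _ = (matPow σ (1 / 2) * Vᴴ) * τ * (V * matPow σ (1 / 2)) := by
          simp only [Matrix.mul_assoc]
      _ = _ := by rw [← h1, ← h2, hXdef]; simp only [Matrix.mul_assoc]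
  -- With K = √X, the compression V(V*XV)V* = (KVV*)*(KVV*) has the same spectrum as K VV* K ≤ X.
  set K := matPow X (1 / 2)
  have hK : Kᴴ = K := (posSemidef_matPow hX _).1.eq
  have hKK : K * K = X := sqrt_mul_sqrt hX
  have hP : (V * Vᴴ)ᴴ = V * Vᴴ := by simp
  rw [e, ← rtr_isometry_conj hV, ← matPow_isometry_conj hV (posSemidef_compress hX V) (by norm_num)]
  have e2 : V * (Vᴴ * X * V) * Vᴴ = (K * (V * Vᴴ))ᴴ * (K * (V * Vᴴ)) := by
    rw [Matrix.conjTranspose_mul, hK, hP, ← hKK]; simp only [Matrix.mul_assoc]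
  have e3 : K * (V * Vᴴ) * (K * (V * Vᴴ))ᴴ = K * (V * Vᴴ) * K := by
    rw [Matrix.conjTranspose_mul, hK, hP, Matrix.mul_assoc, ← Matrix.mul_assoc (V * Vᴴ),
      Matrix.mul_assoc V, ← Matrix.mul_assoc Vᴴ, hV, Matrix.one_mul]
    simp only [Matrix.mul_assoc]
  rw [e2, show rtr (matPow ((K * (V * Vᴴ))ᴴ * (K * (V * Vᴴ))) (1 / 2)) = _ from
    rtr_cfc_conjTranspose_mul _ _, e3]
  have h3 := conj_mono (isometry_mul_conjTranspose_le hV) K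
  have h4 := posSemidef_compress (Matrix.posSemidef_self_mul_conjTranspose V) K
  rw [hK] at h3 h4
  rw [Matrix.mul_one, hKK] at h3
  exact rtr_matPow_mono h4 h3 (by norm_num)

theorem dMin_anti {ρ σ : Matrix n n ℂ} {ρ' σ' : Matrix m m ℂ}
    (h : rootFidelity ρ σ ≤ rootFidelity ρ' σ') : dMin ρ' σ' ≤ dMin ρ σ :=
  coe_mul_elog_anti (by norm_num) h

/-- Since tr ρ = 1, the subnormalisation term of the fidelity vanishes, and closeness becomes a
single lower bound on the root fidelity. -/
theorem mem_epsBall_iff {ε : ℝ} (hε : 0 ≤ ε) {ρ X : Matrix n n ℂ} (hρ : IsState ρ) :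
    X ∈ epsBall ε ρ ↔ IsSubstate X ∧ √(1 - ε ^ 2) ≤ rootFidelity X ρ := by
  have h : fidelity X ρ = rootFidelity X ρ := by
    rw [fidelity, hρ.rtr_eq_one, rootFidelity]; simp
  refine and_congr Iff.rfl ?_
  rw [purifiedDist, h, Real.sqrt_le_iff, Real.sqrt_le_iff]
  have h2 : 0 ≤ rootFidelity X ρ := trNorm_nonneg _
  constructor <;> rintro ⟨-, h1⟩
  · exact ⟨h2, by linarith⟩
  · exact ⟨hε, by linarith⟩

/-- The fidelity with VρV* sees only V*τV. Compression may lose trace, which is why balls of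
substates are the right ones. -/
theorem compress_mem_epsBall {V : Matrix m n ℂ} (hV : Vᴴ * V = 1) {ε : ℝ} (hε : 0 ≤ ε)
    {ρ : Matrix n n ℂ} (hρ : IsState ρ) {τ : Matrix m m ℂ} (hτ : τ ∈ epsBall ε (V * ρ * Vᴴ)) :
    Vᴴ * τ * V ∈ epsBall ε ρ := by
  rw [mem_epsBall_iff hε (isState_conj hV hρ)] at hτ
  rw [mem_epsBall_iff hε hρ, ← rootFidelity_isometry_right hV hτ.1.1 hρ.1]
  refine ⟨⟨posSemidef_compress hτ.1.1 V, ?_⟩, hτ.2⟩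
  have h1 := rtr_mul_mono hτ.1.1 (isometry_mul_conjTranspose_le hV)
  rw [Matrix.mul_one, ← Matrix.mul_assoc, rtr_mul_comm, ← Matrix.mul_assoc] at h1
  exact h1.trans hτ.1.2

theorem conj_mem_epsBall {V : Matrix m n ℂ} (hV : Vᴴ * V = 1) {ε : ℝ} (hε : 0 ≤ ε)
    {ρ ρ' : Matrix n n ℂ} (hρ : IsState ρ) (h : ρ' ∈ epsBall ε ρ) :
    V * ρ' * Vᴴ ∈ epsBall ε (V * ρ * Vᴴ) := by
  rw [mem_epsBall_iff hε hρ] at h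
  have h1 := posSemidef_conj h.1.1 V
  rw [mem_epsBall_iff hε (isState_conj hV hρ), rootFidelity_isometry_right hV h1 hρ.1,
    compress_conj hV]
  refine ⟨⟨h1, ?_⟩, h.2⟩
  have := rtr_isometry_conj hV ρ'
  exact this.le.trans h.1.2

end TraceNorm

/-! ### Amplitudes and the minimax theorem for the fidelity. -/

section Minimax

open scoped MatrixOrder

variable {n : Type*} [Fintype n] [DecidableEq n]

theorem rtr_mul_conjTranspose_self (X : Matrix n n ℂ) :
    rtr (X * Xᴴ) = ∑ i, ∑ j, ‖X i j‖ ^ 2 := by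
  rw [rtr, Matrix.trace, Complex.re_sum]
  refine Finset.sum_congr rfl fun i _ => ?_
  rw [Matrix.diag_apply, Matrix.mul_apply, Complex.re_sum]
  refine Finset.sum_congr rfl fun j _ => ?_
  rw [Matrix.conjTranspose_apply, Complex.star_def, Complex.mul_conj, Complex.ofReal_re,
    Complex.normSq_eq_norm_sq]

theorem isCompact_of_rtr_le {S : Set (Matrix n n ℂ)} (hS : IsClosed S)
    (h : ∀ X ∈ S, rtr (X * Xᴴ) ≤ 1) : IsCompact S := by
  have hc : IsCompact (Set.univ.pi fun _ : n => Set.univ.pi fun _ : n =>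
      Metric.closedBall (0 : ℂ) 1) :=
    isCompact_univ_pi fun _ => isCompact_univ_pi fun _ => isCompact_closedBall _ _
  refine IsCompact.of_isClosed_subset hc hS fun X hX i _ j _ => ?_
  rw [mem_closedBall_zero_iff]
  have h1 := h X hX
  rw [rtr_mul_conjTranspose_self] at h1
  have h2 : ‖X i j‖ ^ 2 ≤ 1 :=
    ((Finset.single_le_sum (f := fun j => ‖X i j‖ ^ 2) (fun j _ => by positivity)
      (Finset.mem_univ j)).trans (Finset.single_le_sum (f := fun i => ∑ j, ‖X i j‖ ^ 2)
      (fun i _ => by positivity) (Finset.mem_univ i))).trans h1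
  nlinarith [norm_nonneg (X i j)]

theorem IsState.eigenvalues_le_one {ρ : Matrix n n ℂ} (h : IsState ρ) (i : n) :
    h.1.1.eigenvalues i ≤ 1 := by
  have h1 := rtr_cfc h.1.1 (fun x => x)
  rw [cfc_self h.1.1, h.rtr_eq_one] at h1
  rw [h1]
  exact Finset.single_le_sum (f := fun i => h.1.1.eigenvalues i)
    (fun i _ => h.1.eigenvalues_nonneg i) (Finset.mem_univ i)

theorem IsState.rtr_sq_le_one {ρ : Matrix n n ℂ} (h : IsState ρ) : rtr (ρ * ρᴴ) ≤ 1 := by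
  have h1 := rtr_cfc h.1.1 (fun x => x)
  have h2 := rtr_cfc h.1.1 (fun x => x * x)
  rw [cfc_self h.1.1, h.rtr_eq_one] at h1
  rw [← cfc_mul_cfc, cfc_self h.1.1] at h2
  rw [h.1.1.eq, h2, h1]
  refine Finset.sum_le_sum fun i _ => ?_
  have := h.eigenvalues_le_one i
  have := h.1.eigenvalues_nonneg i
  nlinarith

theorem isClosed_setOf_mem (N : StarSubalgebra ℂ (Matrix n n ℂ)) :
    IsClosed {x : Matrix n n ℂ | x ∈ N} :=
  N.toSubalgebra.toSubmodule.closed_of_finiteDimensional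

theorem isCompact_stateSpace (N : StarSubalgebra ℂ (Matrix n n ℂ)) :
    IsCompact (stateSpace N) := by
  refine isCompact_of_rtr_le ?_ fun X hX => hX.2.rtr_sq_le_one
  refine (isClosed_setOf_mem N).inter (isClosed_posSemidef.inter ?_)
  exact isClosed_eq continuous_id.matrix_trace continuous_const

theorem convex_stateSpace (N : StarSubalgebra ℂ (Matrix n n ℂ)) : Convex ℝ (stateSpace N) := by
  intro x hx y hy a b ha hb hab
  refine ⟨?_, Matrix.nonneg_iff_posSemidef.1 (add_nonneg (smul_nonneg ha hx.2.1.nonneg)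
    (smul_nonneg hb hy.2.1.nonneg)), ?_⟩
  · rw [← Complex.coe_smul a, ← Complex.coe_smul b]
    exact add_mem (SMulMemClass.smul_mem _ hx.1) (SMulMemClass.smul_mem _ hy.1)
  · rw [Matrix.trace_add, Matrix.trace_smul, Matrix.trace_smul, hx.2.2, hy.2.2, ← add_smul, hab,
      one_smul]

/-- The amplitudes of the substates that are `ε`-close to `ρ`. -/
def amplitudeSet (ε : ℝ) (ρ : Matrix n n ℂ) : Set (Matrix n n ℂ) :=
  {X | rtr (X * Xᴴ) ≤ 1 ∧ √(1 - ε ^ 2) ≤ rtr (matPow ρ (1 / 2) * X)}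

theorem isCompact_amplitudeSet (ε : ℝ) (ρ : Matrix n n ℂ) : IsCompact (amplitudeSet ε ρ) := by
  refine isCompact_of_rtr_le ?_ fun X hX => hX.1
  have h1 : IsClosed {X : Matrix n n ℂ | rtr (X * Xᴴ) ≤ 1} :=
    isClosed_le (continuous_rtr.comp
      (continuous_id.matrix_mul continuous_id.matrix_conjTranspose)) continuous_const
  have h2 : IsClosed {X : Matrix n n ℂ | √(1 - ε ^ 2) ≤ rtr (matPow ρ (1 / 2) * X)} :=
    isClosed_le continuous_const (continuous_rtr.comp (continuous_const.matrix_mul continuous_id))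
  exact h1.inter h2

/-- The set is a Hilbert–Schmidt unit ball cut by a half-space. -/
theorem convex_amplitudeSet (ε : ℝ) (ρ : Matrix n n ℂ) : Convex ℝ (amplitudeSet ε ρ) := by
  intro X hX Y hY a b ha hb hab
  constructor
  · rw [rtr_mul_conjTranspose_self]
    have h1 := hX.1
    have h2 := hY.1
    rw [rtr_mul_conjTranspose_self] at h1 h2
    have : ∀ i j, ‖(a • X + b • Y) i j‖ ^ 2 ≤ a * ‖X i j‖ ^ 2 + b * ‖Y i j‖ ^ 2 := by
      intro i j
      have h3 : ‖(a • X + b • Y) i j‖ ≤ a * ‖X i j‖ + b * ‖Y i j‖ := by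
        refine (norm_add_le _ _).trans (le_of_eq ?_)
        rw [Matrix.smul_apply, Matrix.smul_apply, norm_smul, norm_smul, Real.norm_of_nonneg ha,
          Real.norm_of_nonneg hb]
      have h4 := (convexOn_pow (𝕜 := ℝ) 2).2 (norm_nonneg (X i j)) (norm_nonneg (Y i j)) ha hb hab
      simp only [smul_eq_mul] at h4
      exact (pow_le_pow_left₀ (norm_nonneg _) h3 2).trans h4
    calc _ ≤ ∑ i, ∑ j, (a * ‖X i j‖ ^ 2 + b * ‖Y i j‖ ^ 2) :=
          Finset.sum_le_sum fun i _ => Finset.sum_le_sum fun j _ => this i j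
      _ = a * (∑ i, ∑ j, ‖X i j‖ ^ 2) + b * ∑ i, ∑ j, ‖Y i j‖ ^ 2 := by
          simp only [Finset.sum_add_distrib, Finset.mul_sum]
      _ ≤ a * 1 + b * 1 := by gcongr
      _ = 1 := by linarith
  · rw [mul_add, mul_smul_comm, mul_smul_comm, rtr_add, rtr_smul, rtr_smul]
    calc √(1 - ε ^ 2) = a * √(1 - ε ^ 2) + b * √(1 - ε ^ 2) := by rw [← add_mul, hab, one_mul]
      _ ≤ _ := add_le_add (mul_le_mul_of_nonneg_left hX.2 ha) (mul_le_mul_of_nonneg_left hY.2 hb)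

theorem mul_conjTranspose_mem_epsBall {ε : ℝ} (hε : 0 ≤ ε) {ρ X : Matrix n n ℂ}
    (hρ : IsState ρ) (hX : X ∈ amplitudeSet ε ρ) : X * Xᴴ ∈ epsBall ε ρ := by
  rw [mem_epsBall_iff hε hρ, rootFidelity_mul_conjTranspose X hρ.1]
  refine ⟨⟨Matrix.posSemidef_self_mul_conjTranspose X, hX.1⟩, hX.2.trans ?_⟩
  have := rtr_mul_le_trNorm (W := 1) (by simp) (matPow ρ (1 / 2) * X)
  rwa [one_mul] at this

/-- Take X = √ρ' C with C a contraction attaining the trace norm of √ρ √ρ'. Then Re tr(√ρ X) is the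
fidelity itself, and CC* ≤ 1 gives XX* ≤ ρ'. -/
theorem exists_amplitude_le {ε : ℝ} (hε : 0 ≤ ε) {ρ ρ' : Matrix n n ℂ} (hρ : IsState ρ)
    (h : ρ' ∈ epsBall ε ρ) : ∃ X ∈ amplitudeSet ε ρ, X * Xᴴ ≤ ρ' := by
  rw [mem_epsBall_iff hε hρ] at h
  obtain ⟨C, -, h2, h3⟩ := exists_contraction_rtr_eq (matPow ρ (1 / 2) * matPow ρ' (1 / 2))
  have hs := (posSemidef_matPow h.1.1 (1 / 2)).1.eq
  have hle : matPow ρ' (1 / 2) * C * (matPow ρ' (1 / 2) * C)ᴴ ≤ ρ' := by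
    have h4 := conj_mono h2 (matPow ρ' (1 / 2))
    rw [hs, mul_one, sqrt_mul_sqrt h.1.1] at h4
    rw [Matrix.conjTranspose_mul, hs]
    simpa only [mul_assoc] using h4
  refine ⟨matPow ρ' (1 / 2) * C, ⟨(rtr_mono hle).trans h.1.2, ?_⟩, hle⟩
  rw [← mul_assoc, rtr_mul_comm, h3]
  exact h.2.trans (rootFidelity_comm h.1.1 hρ.1).le

theorem stateSpace_nonempty [Nonempty n] (N : StarSubalgebra ℂ (Matrix n n ℂ)) :
    (stateSpace N).Nonempty := by
  refine ⟨((Fintype.card n : ℂ)⁻¹) • 1, SMulMemClass.smul_mem _ (one_mem N),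
    Matrix.PosSemidef.one.smul ?_, ?_⟩
  · rw [← Complex.ofReal_natCast, ← Complex.ofReal_inv]
    exact_mod_cast inv_nonneg.2 (Nat.cast_nonneg _)
  · rw [Matrix.trace_smul, Matrix.trace_one, smul_eq_mul, inv_mul_cancel₀]
    exact_mod_cast Fintype.card_ne_zero

section
open scoped Matrix.Norms.L2Operator

theorem continuousOn_rtr_sqrt {α : Type*} [TopologicalSpace α] {a : α → Matrix n n ℂ} {s : Set α}
    (ha : ContinuousOn a s) (h : ∀ x ∈ s, (a x).IsHermitian) :
    ContinuousOn (fun x => rtr (matPow (a x) (1 / 2))) s := by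
  refine continuous_rtr.comp_continuousOn ?_
  exact ha.cfc_of_mem_nhdsSet (s := Set.univ) _ Filter.univ_mem (fun x hx => h x hx)
    (Real.continuous_rpow_const (by norm_num)).continuousOn

end

/-- Sion's theorem: the function is tr|√σ X|, convex in X by `trNorm_convex`, and concave in σ
because the square root is operator concave. -/
theorem exists_fidelity_saddle {ε : ℝ} {ρ : Matrix n n ℂ} (hρ : IsState ρ)
    (N : StarSubalgebra ℂ (Matrix n n ℂ)) :
    ∃ X ∈ amplitudeSet ε ρ, ∃ σ ∈ stateSpace N, IsSaddlePointOn (amplitudeSet ε ρ) (stateSpace N)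
      (fun X σ => rtr (matPow (Xᴴ * σ * X) (1 / 2))) X σ := by
  have hne : Nonempty n := by
    by_contra h
    rw [not_nonempty_iff] at h
    have := hρ.2
    simp at this
  refine Sion.exists_isSaddlePointOn ?_ (convex_amplitudeSet ε ρ) (isCompact_amplitudeSet ε ρ)
    ?_ ?_ (convex_stateSpace N) (stateSpace_nonempty N) (isCompact_stateSpace N) ?_ ?_
  · refine ⟨matPow ρ (1 / 2), ?_, ?_⟩
    · rw [(posSemidef_matPow hρ.1 _).1.eq, sqrt_mul_sqrt hρ.1, hρ.rtr_eq_one]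
    · rw [sqrt_mul_sqrt hρ.1, hρ.rtr_eq_one]
      exact Real.sqrt_le_one.2 (by nlinarith [sq_nonneg ε])
  · intro σ hσ
    refine ContinuousOn.lowerSemicontinuousOn ?_
    refine continuousOn_rtr_sqrt (Continuous.continuousOn ?_)
      fun X _ => (posSemidef_compress hσ.2.1 X).1
    exact (continuous_id.matrix_conjTranspose.matrix_mul continuous_const).matrix_mul continuous_id
  · intro σ hσ
    refine ConvexOn.quasiconvexOn ⟨convex_amplitudeSet ε ρ, fun X _ Y _ a b ha hb _ => ?_⟩
    have h := trNorm_convex (matPow σ (1 / 2) * X) (matPow σ (1 / 2) * Y) ha hb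
    rwa [← mul_smul_comm, ← mul_smul_comm, ← mul_add, trNorm_sqrt_mul hσ.2.1,
      trNorm_sqrt_mul hσ.2.1, trNorm_sqrt_mul hσ.2.1] at h
  · intro X _
    refine ContinuousOn.upperSemicontinuousOn ?_
    refine continuousOn_rtr_sqrt (Continuous.continuousOn ?_)
      fun σ hσ => (posSemidef_compress hσ.2.1 X).1
    exact (continuous_const.matrix_mul continuous_id).matrix_mul continuous_const
  · intro X _
    refine ConcaveOn.quasiconcaveOn ⟨convex_stateSpace N, fun σ hσ σ' hσ' a b ha hb hab => ?_⟩
    have h := rtr_mono (matPow_concave (posSemidef_compress hσ.2.1 X)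
      (posSemidef_compress hσ'.2.1 X) (p := 1 / 2) (by norm_num) ha hb hab)
    rw [rtr_add, rtr_smul, rtr_smul] at h
    simpa only [mul_add, add_mul, mul_smul_comm, smul_mul_assoc, smul_eq_mul] using h

end Minimax

/-! ### Smooth entropies relative to N. -/

section Smooth

variable {A E : Type*} [Fintype A] [DecidableEq A] [Fintype E] [DecidableEq E]
  {N : StarSubalgebra ℂ (Matrix A A ℂ)} {V : Matrix (E × A) A ℂ}

theorem EReal.neg_biInf_neg {ι : Type*} (s : Set ι) (f : ι → EReal) :
    -(⨅ i ∈ s, -f i) = ⨆ i ∈ s, f i := by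
  have := EReal.neg_biSup_neg s (fun i => -f i)
  simp only [neg_neg] at this
  rw [← this, neg_neg]

theorem neg_hMinSmooth (ε : ℝ) (τ : Matrix (E × A) (E × A) ℂ) :
    -hMinSmooth ε τ = ⨅ τ' ∈ epsBall ε τ, ⨅ σ ∈ {σ : Matrix A A ℂ | IsState σ},
      dMax τ' (oneTensor E σ) := EReal.neg_biSup_neg _ _

theorem neg_hMaxSmooth (ε : ℝ) (τ : Matrix (E × A) (E × A) ℂ) :
    -hMaxSmooth ε τ = ⨆ τ' ∈ epsBall ε τ, ⨅ σ ∈ {σ : Matrix A A ℂ | IsState σ},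
      dMin τ' (oneTensor E σ) := EReal.neg_biInf_neg _ _

/-- Compression and conjugation by V exchange the two balls; the first, paired with σ ↦ E(σ), does
not increase D_max, and the second preserves it for σ ∈ N. -/
theorem dMaxAlgSmooth_eq (hV : IsStinespringIsometry (condExp N) V) {ρ : Matrix A A ℂ}
    (hρ : IsState ρ) {ε : ℝ} (hε : 0 ≤ ε) :
    dMaxAlgSmooth ε ρ N = -hMinSmooth ε (V * ρ * Vᴴ) := by
  rw [neg_hMinSmooth]
  refine le_antisymm (le_iInf₂ fun τ hτ => le_iInf₂ fun σ hσ => ?_)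
    (le_iInf₂ fun ρ' hρ' => le_iInf₂ fun σ hσ => ?_)
  · refine (iInf₂_le _ (compress_mem_epsBall hV.1 hε hρ hτ)).trans
      ((iInf₂_le _ (condExp_mem_stateSpace hV hσ)).trans ?_)
    rw [← compress_oneTensor hV]
    exact dMax_compress_le _ _ _
  · refine (iInf₂_le _ (conj_mem_epsBall hV.1 hε hρ hρ')).trans ((iInf₂_le σ hσ.2).trans ?_)
    rw [dMax_isometry hV.1 ρ' hσ.2.1 (posSemidef_oneTensor hσ.2.1)
      (oneTensor_mul_isometry hV hσ.1)]

theorem iInf_dMaxSmooth_eq (ε : ℝ) (τ : Matrix (E × A) (E × A) ℂ) :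
    (⨅ σ ∈ {σ : Matrix A A ℂ | IsState σ}, dMaxSmooth ε τ (oneTensor E σ)) =
      -hMinSmooth ε τ := by
  rw [neg_hMinSmooth]
  exact iInf₂_comm _

theorem dMinAlg_eq (hV : IsStinespringIsometry (condExp N) V) {ρ : Matrix A A ℂ}
    (hρ : ρ.PosSemidef) : dMinAlg ρ N = ⨅ σ ∈ {σ : Matrix A A ℂ | IsState σ},
      dMin (V * ρ * Vᴴ) (oneTensor E σ) := by
  have h1 : ((1 : ℝ≥0∞) / 2) ≠ 1 := by
    rw [one_div]; exact (ENNReal.inv_lt_one.2 ENNReal.one_lt_two).ne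
  have h := dAlphaAlg_eq_of_ne_one hV hρ le_rfl h1
  have e1 : dAlphaAlg (1 / 2) ρ N = dMinAlg ρ N :=
    iInf_congr fun σ => iInf_congr fun hσ => dAlpha_half hρ hσ.2.1
  rw [← e1, h]
  exact iInf_congr fun σ => iInf_congr fun hσ =>
    dAlpha_half (posSemidef_conj hρ V) (posSemidef_oneTensor hσ.1)

theorem dMinAlgSmooth_le (hV : IsStinespringIsometry (condExp N) V) {ρ : Matrix A A ℂ}
    (hρ : IsState ρ) {ε : ℝ} (hε : 0 ≤ ε) :
    dMinAlgSmooth ε ρ N ≤ -hMaxSmooth ε (V * ρ * Vᴴ) := by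
  rw [neg_hMaxSmooth]
  refine iSup₂_le fun ρ' hρ' => ?_
  rw [dMinAlg_eq hV hρ'.1.1]
  exact le_iSup₂ (f := fun τ' (_ : τ' ∈ epsBall ε (V * ρ * Vᴴ)) =>
    ⨅ σ ∈ {σ : Matrix A A ℂ | IsState σ}, dMin τ' (oneTensor E σ)) _
    (conj_mem_epsBall hV.1 hε hρ hρ')

/-- Weak minimax: sup inf ≤ inf sup. -/
theorem neg_hMaxSmooth_le (ε : ℝ) (τ : Matrix (E × A) (E × A) ℂ) :
    -hMaxSmooth ε τ ≤
      ⨅ σ ∈ {σ : Matrix A A ℂ | IsState σ}, dMinSmooth ε τ (oneTensor E σ) := by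
  rw [neg_hMaxSmooth]
  refine iSup₂_le fun τ' hτ' => le_iInf₂ fun σ hσ => (iInf₂_le σ hσ).trans ?_
  exact le_iSup₂ (f := fun τ' (_ : τ' ∈ epsBall ε τ) => dMin τ' (oneTensor E σ)) τ' hτ'

/-- The only direction needing strong minimax: the saddle point gives a σ ∈ N good against the whole
ball, and one substate XX* good against all of N. -/
theorem iInf_dMinSmooth_le (hV : IsStinespringIsometry (condExp N) V) {ρ : Matrix A A ℂ}
    (hρ : IsState ρ) {ε : ℝ} (hε : 0 ≤ ε) :
    (⨅ σ ∈ {σ : Matrix A A ℂ | IsState σ}, dMinSmooth ε (V * ρ * Vᴴ) (oneTensor E σ)) ≤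
      dMinAlgSmooth ε ρ N := by
  obtain ⟨X, hX, σ, hσ, hs⟩ := exists_fidelity_saddle (ε := ε) hρ N
  have hf : ∀ (Y : Matrix A A ℂ) {ω : Matrix A A ℂ}, ω.PosSemidef →
      rtr (matPow (Yᴴ * ω * Y) (1 / 2)) = rootFidelity (Y * Yᴴ) ω := fun Y ω hω => by
    rw [rootFidelity_mul_conjTranspose Y hω, trNorm_sqrt_mul hω]
  refine (iInf₂_le σ hσ.2).trans (iSup₂_le fun τ hτ => ?_)
  have hρ' := compress_mem_epsBall hV.1 hε hρ hτ
  obtain ⟨Y, hY, hYle⟩ := exists_amplitude_le hε hρ hρ'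
  refine le_trans ?_ (le_iSup₂ (f := fun ρ' (_ : ρ' ∈ epsBall ε ρ) => dMinAlg ρ' N) _
    (mul_conjTranspose_mem_epsBall hε hρ hX))
  refine le_iInf₂ fun ω hω => dMin_anti ?_
  -- In fidelities the chain is F(XX*, ω) ≤ F(YY*, σ) ≤ F(V*τV, σ) ≤ F(τ, 1 ⊗ σ); D_min reverses it.
  have h1 := hs Y hY ω hω
  simp only [hf _ hω.2.1, hf _ hσ.2.1] at h1
  refine h1.trans ((rootFidelity_mono_left (Matrix.posSemidef_self_mul_conjTranspose Y) hYle
    hσ.2.1).trans ?_)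
  exact rootFidelity_compress_le hV.1 hτ.1.1 (posSemidef_oneTensor hσ.2.1) hσ.2.1
    (oneTensor_mul_isometry hV hσ.1)

end Smooth

/-! ### Bounds on the sandwiched trace near α = 1. -/

section SandwichBounds

open scoped MatrixOrder Matrix.Norms.L2Operator

variable {n A E : Type*} [Fintype n] [DecidableEq n] [Fintype A] [DecidableEq A]
  [Fintype E] [DecidableEq E]

theorem rtr_cfc_mul_sandwich {ρ : Matrix n n ℂ} (hρ : ρ.PosSemidef) (h : ℝ → ℝ)
    (M : Matrix n n ℂ) : rtr (cfc h ρ * (matPow ρ (1 / 2) * M * matPow ρ (1 / 2))) =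
      rtr (cfc (fun y => y * h y) ρ * M) := by
  have e : matPow ρ (1 / 2) * cfc h ρ * matPow ρ (1 / 2) = cfc (fun y => y * h y) ρ := by
    rw [matPow, cfc_mul_cfc, cfc_mul_cfc]
    refine cfc_congr_nonneg hρ fun x hx => ?_
    have : x ^ (1 / 2 : ℝ) * x ^ (1 / 2 : ℝ) = x := by
      rw [← Real.sqrt_eq_rpow, Real.mul_self_sqrt hx]
    rw [mul_right_comm, this]
  rw [← e, ← mul_assoc, rtr_mul_comm]
  simp only [mul_assoc]

theorem rtr_matPow_sub_one_mul_sandwich {ρ : Matrix n n ℂ} (hρ : ρ.PosSemidef) {a : ℝ}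
    (ha : a ≠ 0) (M : Matrix n n ℂ) :
    rtr (matPow ρ (a - 1) * (matPow ρ (1 / 2) * M * matPow ρ (1 / 2))) =
      rtr (matPow ρ a * M) := by
  rw [matPow, rtr_cfc_mul_sandwich hρ]
  congr 2
  refine cfc_congr_nonneg hρ fun x hx => ?_
  rcases hx.eq_or_lt with rfl | hx
  · simp [Real.zero_rpow ha]
  · rw [Real.rpow_sub_one hx.ne', mul_div_cancel₀ _ hx.ne']

theorem posSemidef_sandwich {ρ M : Matrix n n ℂ} (hρ : ρ.PosSemidef) (hM : M.PosSemidef) :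
    (matPow ρ (1 / 2) * M * matPow ρ (1 / 2)).PosSemidef := by
  have := posSemidef_compress hM (matPow ρ (1 / 2))
  rwa [(posSemidef_matPow hρ _).1.eq] at this

theorem sandwich_mono {ρ M M' : Matrix n n ℂ} (hρ : ρ.PosSemidef) (h : M ≤ M') :
    matPow ρ (1 / 2) * M * matPow ρ (1 / 2) ≤ matPow ρ (1 / 2) * M' * matPow ρ (1 / 2) := by
  have := conj_mono h (matPow ρ (1 / 2))
  rwa [(posSemidef_matPow hρ _).1.eq] at this

theorem tendsto_cfc_mul_shift {ρ : Matrix n n ℂ} (hρ : ρ.PosSemidef) {a : ℝ} (ha : a ≠ 0) :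
    Filter.Tendsto (fun η : ℝ => cfc (fun y : ℝ => y * (y + η) ^ (a - 1)) ρ) (𝓝[>] 0)
      (𝓝 (matPow ρ a)) := by
  refine tendsto_cfc_of_pointwise hρ.1 fun y hy => ?_
  rcases (spectrum_nonneg hρ hy).eq_or_lt with rfl | hy
  · simp [Real.zero_rpow ha]
  · have h : ContinuousAt (fun η : ℝ => y * (y + η) ^ (a - 1)) 0 :=
      continuousAt_const.mul (ContinuousAt.rpow_const (by fun_prop)
        (Or.inl (by simpa using hy.ne')))
    have h2 := h.tendsto
    rw [add_zero, Real.rpow_sub_one hy.ne', mul_div_cancel₀ _ hy.ne'] at h2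
    exact h2.mono_left nhdsWithin_le_nhds

theorem tendsto_cfc_shift {ρ : Matrix n n ℂ} (hρ : ρ.PosSemidef) {a : ℝ} (ha : 0 < a) :
    Filter.Tendsto (fun η : ℝ => cfc (fun y : ℝ => (y + η) ^ a) ρ) (𝓝[>] 0)
      (𝓝 (matPow ρ a)) := by
  refine tendsto_cfc_of_pointwise hρ.1 fun y _ => ?_
  have h : ContinuousAt (fun η : ℝ => (y + η) ^ a) 0 :=
    ContinuousAt.rpow_const (by fun_prop) (Or.inr ha.le)
  have h2 := h.tendsto
  rw [add_zero] at h2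
  exact h2.mono_left nhdsWithin_le_nhds

/-- The tangent bound for the concave power, taken at ρ: with X = √ρ M √ρ one has tr(ρ^(a-1) X) =
tr(ρ^a M). The shift η handles singular ρ and tends to 0. -/
theorem sandwichTr_le {ρ σ : Matrix n n ℂ} (hρ : ρ.PosSemidef) (hσ : σ.PosSemidef) {a : ℝ}
    (h0 : 0 < a) (h1 : a < 1) : sandwichTr a ρ σ ≤
      (1 - a) * rtr (matPow ρ a) + a * rtr (matPow ρ a * matPow σ ((1 - a) / a)) := by
  rw [sandwichTr_eq hρ hσ]
  set M := matPow σ ((1 - a) / a)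
  have hX := posSemidef_sandwich hρ (posSemidef_matPow hσ ((1 - a) / a))
  have hlim : Filter.Tendsto (fun η : ℝ => (1 - a) * rtr (cfc (fun y : ℝ => (y + η) ^ a) ρ) +
      a * rtr (cfc (fun y : ℝ => y * (y + η) ^ (a - 1)) ρ * M)) (𝓝[>] 0)
      (𝓝 ((1 - a) * rtr (matPow ρ a) + a * rtr (matPow ρ a * M))) := by
    refine Filter.Tendsto.add (Filter.Tendsto.const_mul _ ?_) (Filter.Tendsto.const_mul _ ?_)
    · exact (continuous_rtr.tendsto _).comp (tendsto_cfc_shift hρ h0)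
    · exact (continuous_rtr.tendsto _).comp
        ((tendsto_cfc_mul_shift hρ h0.ne').mul tendsto_const_nhds)
  refine ge_of_tendsto hlim (Filter.eventually_of_mem self_mem_nhdsWithin fun η hη => ?_)
  rw [← rtr_cfc_mul_sandwich hρ]
  exact rtr_matPow_le_tangent hX hρ h0 h1 hη

theorem le_sandwichTr_of_one_lt {ρ σ : Matrix n n ℂ} (hρ : ρ.PosSemidef) (hσ : σ.PosSemidef)
    {a : ℝ} (h1 : 1 < a) :
    (1 - a) * rtr (matPow ρ a) + a * rtr (matPow ρ a * matPow σ ((1 - a) / a)) ≤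
      sandwichTr a ρ σ := by
  rw [sandwichTr_eq hρ hσ, ← rtr_matPow_sub_one_mul_sandwich hρ (by linarith)]
  exact rtr_matPow_tangent_le (posSemidef_sandwich hρ (posSemidef_matPow hσ _)) hρ h1

/-- Since X ≤ ρ and the power a - 1 is antitone, tr X^a = tr(X X^(a-1)) ≥ tr(X ρ^(a-1)). -/
theorem le_sandwichTr_of_lt_one {ρ σ : Matrix n n ℂ} (hρ : ρ.PosSemidef) (hσ : σ.PosSemidef)
    {a : ℝ} (h0 : 0 < a) (h1 : a < 1) (hσ1 : matPow σ ((1 - a) / a) ≤ 1) :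
    rtr (matPow ρ a * matPow σ ((1 - a) / a)) ≤ sandwichTr a ρ σ := by
  rw [sandwichTr_eq hρ hσ]
  set M := matPow σ ((1 - a) / a)
  have hX := posSemidef_sandwich hρ (posSemidef_matPow hσ ((1 - a) / a))
  set X := matPow ρ (1 / 2) * M * matPow ρ (1 / 2)
  have hXρ : X ≤ ρ := by
    have := sandwich_mono hρ hσ1
    rwa [mul_one, sqrt_mul_sqrt hρ] at this
  have hl1 := (continuous_rtr.tendsto _).comp (tendsto_cfc_mul_shift hX h0.ne')
  have hl2 := (continuous_rtr.tendsto _).comp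
    ((tendsto_cfc_mul_shift hρ h0.ne').mul (tendsto_const_nhds (x := M)))
  refine le_of_tendsto_of_tendsto hl2 hl1
    (Filter.eventually_of_mem self_mem_nhdsWithin fun η hη => ?_)
  have h := rtr_mul_mono hX (cfc_shift_antitone hX hXρ hη (t := 1 - a)
    ⟨by linarith, by linarith⟩)
  rw [neg_sub, rtr_mul_comm, rtr_cfc_mul_sandwich hρ] at h
  refine h.trans (le_of_eq ?_)
  conv_lhs => enter [1, 1]; rw [← cfc_self hX.1]
  rw [cfc_mul_cfc]
  rfl

theorem matPow_smul {ρ : Matrix n n ℂ} (hρ : ρ.PosSemidef) {c : ℝ} (hc : 0 ≤ c) (p : ℝ) :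
    matPow (c • ρ) p = c ^ p • matPow ρ p := by
  have h : c • ρ = cfc (fun x : ℝ => c * x) ρ := by
    rw [cfc_const_mul _ _ _ (continuousOn_spectrum _ _), cfc_self hρ.1]
  rw [h, matPow, cfc_cfc _ _ hρ.1, matPow, ← cfc_const_mul _ _ _ (continuousOn_spectrum _ _)]
  exact cfc_congr_nonneg hρ fun x hx => Real.mul_rpow hc hx

theorem sandwichTr_le_of_one_lt {ρ σ : Matrix n n ℂ} (hρ : ρ.PosSemidef) (hσ : σ.PosSemidef)
    {a c : ℝ} (h1 : 1 < a) (h2 : a ≤ 2) (hc : 0 < c) (hcσ : ∀ x ∈ spectrum ℝ σ, x = 0 ∨ c ≤ x) :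
    sandwichTr a ρ σ ≤
      c ^ ((1 - a) / a * (a - 1)) * rtr (matPow ρ a * matPow σ ((1 - a) / a)) := by
  have hs : (1 - a) / a < 0 := div_neg_of_neg_of_pos (by linarith) (by linarith)
  rw [sandwichTr_eq hρ hσ]
  set s := (1 - a) / a
  have hX := posSemidef_sandwich hρ (posSemidef_matPow hσ s)
  set X := matPow ρ (1 / 2) * matPow σ s * matPow ρ (1 / 2) with hXdef
  have hσle : matPow σ s ≤ c ^ s • 1 := by
    rw [← cfc_const_eq hσ.1]
    refine cfc_le_cfc fun x hx => ?_
    rcases hcσ x hx with rfl | h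
    · rw [Real.zero_rpow hs.ne]; positivity
    · exact Real.rpow_le_rpow_of_nonpos hc h hs.le
  have hXρ : X ≤ c ^ s • ρ := by
    have := sandwich_mono hρ hσle
    rwa [mul_smul_comm, mul_one, smul_mul_assoc, sqrt_mul_sqrt hρ] at this
  -- Write X^a = X · X^(a-1) and use X ≤ c^s ρ; a ≤ 2 keeps the power a - 1 operator monotone.
  have h3 := rtr_mul_mono hX (matPow_mono hX hXρ (p := a - 1) ⟨by linarith, by linarith⟩)
  rw [matPow_smul hρ (by positivity), mul_smul_comm, rtr_smul, rtr_mul_comm X (matPow ρ _), hXdef,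
    rtr_matPow_sub_one_mul_sandwich hρ (by linarith), ← hXdef, rtr_mul_comm,
    matPow_sub_one_mul hX (by linarith), ← Real.rpow_mul hc.le] at h3
  exact h3

theorem exists_spectral_gap {σ : Matrix n n ℂ} (hσ : σ.PosSemidef) :
    ∃ c : ℝ, 0 < c ∧ ∀ x ∈ spectrum ℝ σ, x = 0 ∨ c ≤ x := by
  let s := (Matrix.finite_real_spectrum (A := σ)).toFinset.filter (· ≠ 0)
  rcases s.eq_empty_or_nonempty with h | h
  · refine ⟨1, one_pos, fun x hx => Or.inl ?_⟩
    by_contra h0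
    have : x ∈ s := by simp [s, hx, h0]
    rw [h] at this
    simp at this
  · refine ⟨s.min' h, ?_, fun x hx => ?_⟩
    · have h1 := s.min'_mem h
      simp only [s, Finset.mem_filter, Set.Finite.mem_toFinset] at h1
      exact lt_of_le_of_ne (spectrum_nonneg hσ h1.1) (Ne.symm h1.2)
    · by_cases h0 : x = 0
      · exact Or.inl h0
      · exact Or.inr (s.min'_le x (by simp [s, hx, h0]))

theorem IsState.spectrum_le_one {ρ : Matrix n n ℂ} (h : IsState ρ) {x : ℝ}
    (hx : x ∈ spectrum ℝ ρ) : x ≤ 1 := by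
  rw [h.1.1.spectrum_real_eq_range_eigenvalues] at hx
  obtain ⟨i, rfl⟩ := hx
  exact h.eigenvalues_le_one i

theorem IsState.matPow_le_one {ρ : Matrix n n ℂ} (h : IsState ρ) {p : ℝ} (hp : 0 ≤ p) :
    matPow ρ p ≤ 1 := by
  rw [← cfc_one ℝ ρ h.1.1.isSelfAdjoint]
  exact cfc_le_cfc fun x hx =>
    Real.rpow_le_one (spectrum_nonneg h.1 hx) (h.spectrum_le_one hx) hp

theorem oneTensor_le_one {X : Matrix A A ℂ} (h : X ≤ 1) : oneTensor E X ≤ 1 := by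
  rw [Matrix.le_iff] at h ⊢
  have := posSemidef_oneTensor (E := E) h
  have e : oneTensor E (1 - X) = 1 - oneTensor E X := eq_sub_of_add_eq <| by
    rw [oneTensor, oneTensor, ← Matrix.kronecker_add, sub_add_cancel, ← oneTensor, oneTensor_one]
  rwa [e] at this

/-- Upper bound on the sandwiched quantity below `α = 1`, uniform in the second argument. -/
theorem sandwichTr_oneTensor_le {τ : Matrix (E × A) (E × A) ℂ} (hτ : IsState τ)
    {σ : Matrix A A ℂ} (hσ : IsState σ) {a : ℝ} (h0 : 1 / 2 < a) (h1 : a < 1) :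
    sandwichTr a τ (oneTensor E σ) ≤ rtr (matPow τ a) +
      (2 * a - 1) * (rtr (matPow (ptraceE τ) (a / (2 * a - 1))) - 1) := by
  have hT := isState_ptraceE hτ
  have ha : 0 < a := by linarith
  have hs0 : 0 ≤ (1 - a) / a := div_nonneg (by linarith) ha.le
  have hle := sandwichTr_le hτ.1 (posSemidef_oneTensor (E := E) hσ.1) ha h1
  have hs1 : 0 < 1 - (1 - a) / a := by
    rw [sub_pos, div_lt_one ha]; linarith
  rw [matPow_oneTensor hσ.1.1] at hle
  -- Split τ^a = τ + (τ^a - τ). The second part is positive, so 1 ⊗ σ^s ≤ 1 removes σ from it; the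
  -- first reduces to τ_A.
  have h2 : rtr (matPow τ a * oneTensor E (matPow σ ((1 - a) / a))) ≤
      rtr (ptraceE τ * matPow σ ((1 - a) / a)) + rtr (matPow τ a) - 1 := by
    have h3 : 0 ≤ matPow τ a - τ := by
      rw [sub_nonneg]
      conv_lhs => rw [← cfc_self hτ.1.1]
      refine cfc_le_cfc fun x hx => ?_
      have := Real.rpow_le_rpow_of_exponent_ge' (spectrum_nonneg hτ.1 hx)
        (hτ.spectrum_le_one hx) ha.le h1.le
      rwa [Real.rpow_one] at this
    have h4 := rtr_mul_mono (Matrix.nonneg_iff_posSemidef.1 h3)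
      (oneTensor_le_one (E := E) (hσ.matPow_le_one hs0))
    rw [mul_one, sub_mul, rtr_sub, rtr_sub, rtr_mul_oneTensor τ, hτ.rtr_eq_one] at h4
    linarith
  -- Weighted AM-GM with s = (1-a)/a. The exponent a/(2a-1) = 1/(1-s) makes τ_A appear to the first
  -- power in the geometric mean, and tr σ = 1 eliminates σ.
  have h5 : rtr (ptraceE τ * matPow σ ((1 - a) / a)) ≤
      (1 - (1 - a) / a) * rtr (matPow (ptraceE τ) (a / (2 * a - 1))) + (1 - a) / a := by
    have h6 := klein_nonneg hT.1 hσ.1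
      (f := fun x => (1 - (1 - a) / a) * x ^ (a / (2 * a - 1)))
      (g := fun y => (1 - a) / a * y) (h := fun y => (-1) * y ^ ((1 - a) / a)) fun x y hx hy => by
        have h7 := Real.geom_mean_le_arith_mean2_weighted hs1.le hs0
          (Real.rpow_nonneg hx (a / (2 * a - 1))) hy (by ring)
        rw [← Real.rpow_mul hx] at h7
        have h8 : a / (2 * a - 1) * (1 - (1 - a) / a) = 1 := by
          have : 2 * a - 1 ≠ 0 := by linarith
          rw [show 1 - (1 - a) / a = (2 * a - 1) / a by field_simp; ring,
            div_mul_div_comm, mul_comm a, div_self (mul_ne_zero this ha.ne')]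
        rw [h8, Real.rpow_one] at h7
        linarith
    rw [cfc_const_mul _ _ _ (continuousOn_spectrum _ _),
      cfc_const_mul _ _ _ (continuousOn_spectrum _ _),
      cfc_const_mul _ _ _ (continuousOn_spectrum _ _), rtr_smul, rtr_smul, smul_mul_assoc,
      rtr_smul, cfc_self hσ.1.1, hσ.rtr_eq_one, rtr_mul_comm] at h6
    simp only [matPow]
    linarith
  have h9 : a * rtr (matPow τ a * oneTensor E (matPow σ ((1 - a) / a))) ≤
      a * ((1 - (1 - a) / a) * rtr (matPow (ptraceE τ) (a / (2 * a - 1))) + (1 - a) / a +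
        rtr (matPow τ a) - 1) := by
    refine mul_le_mul_of_nonneg_left ?_ ha.le
    linarith
  have h10 : a * ((1 - (1 - a) / a) * rtr (matPow (ptraceE τ) (a / (2 * a - 1))) + (1 - a) / a +
        rtr (matPow τ a) - 1) = (2 * a - 1) * rtr (matPow (ptraceE τ) (a / (2 * a - 1))) +
        (1 - a) + a * (rtr (matPow τ a) - 1) := by
    field_simp
    ring
  rw [h10] at h9
  linarith

/-- Lower bound on the sandwiched quantity above `α = 1`, uniform in the second argument. -/
theorem le_sandwichTr_oneTensor {τ : Matrix (E × A) (E × A) ℂ} (hτ : IsState τ)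
    {σ : Matrix A A ℂ} (hσ : IsState σ) (hsupp : SuppLE τ (oneTensor E σ)) {a : ℝ} (h1 : 1 < a) :
    (1 - a) * rtr (matPow τ a) + a * (1 + (a - 1) * (Real.log 2 * rtr (τ * matLog τ))) +
      (1 - a) * (Real.log 2 * rtr (ptraceE τ * matLog (ptraceE τ))) ≤
      sandwichTr a τ (oneTensor E σ) := by
  have hT := isState_ptraceE hτ
  have ha : 0 < a := by linarith
  have hs0 : (1 - a) / a < 0 := div_neg_of_neg_of_pos (by linarith) ha
  have hl2 : 0 < Real.log 2 := Real.log_pos one_lt_two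
  have hσ' := posSemidef_oneTensor (E := E) hσ.1
  refine le_trans ?_ (le_sandwichTr_of_one_lt hτ.1 hσ' h1)
  obtain ⟨w, hw, hfg, hz⟩ := exists_spectral_weights_of_suppLE hτ.1 hσ' hsupp
  have e1 := hfg (fun x => x) (fun _ => 1)
  have e2 := hfg (fun x => x * Real.logb 2 x) (fun _ => 1)
  have e3 := hfg (fun x => x) (fun x => Real.logb 2 x)
  have e4 := hfg (fun x => x ^ a) (fun x => x ^ ((1 - a) / a))
  rw [cfc_self hτ.1.1] at e1 e3
  rw [cfc_const_eq hσ'.1, one_smul, mul_one] at e1 e2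
  rw [hτ.rtr_eq_one] at e1
  rw [← mul_matLog_eq hτ.1.1] at e2
  have key : 1 + (a - 1) * Real.log 2 * rtr (τ * matLog τ) +
      (1 - a) / a * Real.log 2 * rtr (τ * matLog (oneTensor E σ)) ≤
      rtr (matPow τ a * matPow (oneTensor E σ) ((1 - a) / a)) := by
    rw [e2, show rtr (τ * matLog (oneTensor E σ)) = _ from e3,
      show rtr (matPow τ a * matPow (oneTensor E σ) ((1 - a) / a)) = _ from e4]
    conv_lhs => enter [1, 1]; rw [e1]
    simp only [Finset.mul_sum, ← Finset.sum_add_distrib]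
    refine Finset.sum_le_sum fun i _ => Finset.sum_le_sum fun j _ => ?_
    have hr := hτ.1.eigenvalues_nonneg i
    have hq := hσ'.eigenvalues_nonneg j
    set r := hτ.1.1.eigenvalues i
    set q := hσ'.1.eigenvalues j
    have hzij : 0 < q ∨ w i j = 0 ∨ r = 0 := hz i j
    rcases hzij with hq | h0 | h0
    · rcases hr.eq_or_lt with h0 | hr
      · rw [← h0, Real.zero_rpow ha.ne']; simp
      · have h3 := Real.add_one_le_exp ((a - 1) * Real.log r + (1 - a) / a * Real.log q)
        have h4 : r * Real.exp ((a - 1) * Real.log r + (1 - a) / a * Real.log q) =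
            r ^ a * q ^ ((1 - a) / a) := by
          rw [Real.exp_add, mul_comm (a - 1), mul_comm ((1 - a) / a), ← Real.rpow_def_of_pos hr,
            ← Real.rpow_def_of_pos hq, Real.rpow_sub_one hr.ne']
          field_simp
        rw [← h4]
        have h5 := mul_le_mul_of_nonneg_left (mul_le_mul_of_nonneg_left h3 hr.le) (hw i j)
        refine le_trans (le_of_eq ?_) h5
        simp only [Real.logb]
        field_simp
        ring
    · simp [h0]
    · rw [h0, Real.zero_rpow ha.ne']; simp
  have h2 : rtr (τ * matLog (oneTensor E σ)) ≤ rtr (ptraceE τ * matLog (ptraceE τ)) := by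
    rw [matLog_oneTensor hσ.1.1, rtr_mul_oneTensor]
    exact rtr_mul_matLog_le hT hσ ((suppLE_oneTensor_iff hτ.1 hσ.1).1 hsupp)
  have h3 := mul_le_mul_of_nonneg_left key ha.le
  have h4 : a * (1 + (a - 1) * Real.log 2 * rtr (τ * matLog τ) +
      (1 - a) / a * Real.log 2 * rtr (τ * matLog (oneTensor E σ))) =
      a * (1 + (a - 1) * (Real.log 2 * rtr (τ * matLog τ))) +
      (1 - a) * (Real.log 2 * rtr (τ * matLog (oneTensor E σ))) := by
    field_simp
  have h5 : (1 - a) * (Real.log 2 * rtr (ptraceE τ * matLog (ptraceE τ))) ≤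
      (1 - a) * (Real.log 2 * rtr (τ * matLog (oneTensor E σ))) :=
    mul_le_mul_of_nonpos_left (mul_le_mul_of_nonneg_left h2 hl2.le) (by linarith)
  rw [h4] at h3
  linarith

end SandwichBounds

/-! ### The limits at α = 1. -/

section Limits

open scoped MatrixOrder Matrix.Norms.L2Operator

variable {n A E : Type*} [Fintype n] [DecidableEq n] [Fintype A] [DecidableEq A]
  [Fintype E] [DecidableEq E]

/-- Since log B(1) = 0, the expression is the slope of log₂ B at 1. -/
theorem tendsto_mul_elog {B : ℝ → ℝ} {D : ℝ} (h1 : B 1 = 1) (hB : HasDerivAt B D 1) :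
    Filter.Tendsto (fun a : ℝ => ((1 / (a - 1) : ℝ) : EReal) * elog (B a)) (𝓝[≠] 1)
      (𝓝 ((D / Real.log 2 : ℝ) : EReal)) := by
  have h2 := (hB.log (by rw [h1]; exact one_ne_zero)).div_const (Real.log 2)
  rw [h1, div_one, hasDerivAt_iff_tendsto_slope] at h2
  refine ((continuous_coe_real_ereal.tendsto _).comp h2).congr' ?_
  have hpos : ∀ᶠ a in 𝓝[≠] (1 : ℝ), 0 < B a :=
    nhdsWithin_le_nhds (hB.continuousAt.eventually (lt_mem_nhds (by rw [h1]; exact one_pos)))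
  filter_upwards [hpos] with a ha
  rw [elog, if_neg ha.not_ge, ← EReal.coe_mul, Function.comp_apply, slope_def_field, h1,
    Real.log_one, zero_div, sub_zero, Real.logb, one_div_mul_eq_div]

theorem hasDerivAt_rpow_one {r : ℝ} (hr : 0 ≤ r) :
    HasDerivAt (fun a : ℝ => r ^ a) (r * Real.log r) 1 := by
  rcases hr.eq_or_lt with rfl | hr
  · rw [zero_mul]
    refine (hasDerivAt_const (1 : ℝ) (0 : ℝ)).congr_of_eventuallyEq ?_
    filter_upwards [lt_mem_nhds (one_pos : (0 : ℝ) < 1)] with a ha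
    rw [Real.zero_rpow ha.ne']
  · have := (Real.hasStrictDerivAt_const_rpow hr 1).hasDerivAt
    rwa [Real.rpow_one] at this

theorem hasDerivAt_rpow_comp {q : ℝ} (hq : 0 < q) {e : ℝ → ℝ} {e' : ℝ} (h1 : e 1 = 0)
    (he : HasDerivAt e e' 1) : HasDerivAt (fun a => q ^ e a) (Real.log q * e') 1 := by
  have h := (Real.hasStrictDerivAt_const_rpow hq (e 1)).hasDerivAt.comp 1 he
  rwa [h1, Real.rpow_zero, one_mul] at h

theorem hasDerivAt_one_sub_div : HasDerivAt (fun a : ℝ => (1 - a) / a) (-1) 1 := by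
  refine (((hasDerivAt_id' (1 : ℝ)).const_sub 1).fun_div (hasDerivAt_id' (1 : ℝ))
    one_ne_zero).congr_deriv ?_
  norm_num

theorem hasDerivAt_rtr_matPow {X : Matrix n n ℂ} (hX : X.PosSemidef) :
    HasDerivAt (fun a : ℝ => rtr (matPow X a)) (Real.log 2 * rtr (X * matLog X)) 1 := by
  have hl2 : Real.log 2 ≠ 0 := (Real.log_pos one_lt_two).ne'
  rw [mul_matLog_eq hX.1, rtr_cfc hX.1, Finset.mul_sum]
  simp only [matPow, rtr_cfc hX.1]
  refine HasDerivAt.fun_sum fun i _ => ?_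
  refine (hasDerivAt_rpow_one (hX.eigenvalues_nonneg i)).congr_deriv ?_
  simp only [Real.logb]
  field_simp

/-- In spectral weights this is a finite sum of terms r^a q^((1-a)/a); by the support condition each
has q > 0 or vanishes near a = 1. -/
theorem hasDerivAt_rtr_matPow_mul {ρ σ : Matrix n n ℂ} (hρ : ρ.PosSemidef) (hσ : σ.PosSemidef)
    (h : SuppLE ρ σ) : HasDerivAt (fun a : ℝ => rtr (matPow ρ a * matPow σ ((1 - a) / a)))
      (Real.log 2 * (rtr (ρ * matLog ρ) - rtr (ρ * matLog σ))) 1 := by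
  have hl2 : Real.log 2 ≠ 0 := (Real.log_pos one_lt_two).ne'
  obtain ⟨w, -, hfg, hz⟩ := exists_spectral_weights_of_suppLE hρ hσ h
  have e2 := hfg (fun x => x * Real.logb 2 x) (fun _ => 1)
  have e3 := hfg (fun x => x) (fun x => Real.logb 2 x)
  rw [cfc_self hρ.1] at e3
  rw [cfc_const_eq hσ.1, one_smul, mul_one, ← mul_matLog_eq hρ.1] at e2
  rw [e2, show rtr (ρ * matLog σ) = _ from e3, ← Finset.sum_sub_distrib, Finset.mul_sum]
  simp only [matPow, hfg]
  refine HasDerivAt.fun_sum fun i _ => ?_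
  rw [← Finset.sum_sub_distrib, Finset.mul_sum]
  refine HasDerivAt.fun_sum fun j _ => ?_
  have hr := hρ.eigenvalues_nonneg i
  have hzij := hz i j
  generalize hρ.1.eigenvalues i = r at *
  generalize hσ.1.eigenvalues j = q at *
  rcases hzij with hq | h0 | h0
  · refine (((hasDerivAt_rpow_one hr).fun_mul (hasDerivAt_rpow_comp hq (by norm_num)
      hasDerivAt_one_sub_div)).const_mul (w i j)).congr_deriv ?_
    simp only [Real.logb, sub_self, zero_div, Real.rpow_zero, Real.rpow_one]
    field_simp
    ring
  · simpa [h0] using hasDerivAt_const (1 : ℝ) (0 : ℝ)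
  · have h1 := (hasDerivAt_const (1 : ℝ) (0 : ℝ))
    rw [h0]
    simp only [zero_mul, mul_zero, sub_self]
    refine h1.congr_of_eventuallyEq ?_
    filter_upwards [lt_mem_nhds (one_pos : (0 : ℝ) < 1)] with a ha
    rw [Real.zero_rpow ha.ne', zero_mul, mul_zero]

theorem tendsto_toReal_nhdsNE_one :
    Filter.Tendsto ENNReal.toReal (𝓝[≠] 1) (𝓝[≠] 1) := by
  refine tendsto_nhdsWithin_iff.2 ⟨?_, ?_⟩
  · exact (ENNReal.tendsto_toReal ENNReal.one_ne_top).mono_left nhdsWithin_le_nhds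
  · refine Filter.eventually_of_mem self_mem_nhdsWithin fun α hα h => hα ?_
    exact (ENNReal.toReal_eq_one_iff α).1 h

theorem dAlpha_eq_of_lt_one {α : ℝ≥0∞} (h : α < 1) (ρ σ : Matrix n n ℂ) :
    dAlpha α ρ σ = ((1 / (α.toReal - 1) : ℝ) : EReal) * elog (sandwichTr α.toReal ρ σ) := by
  rw [dAlpha, if_neg (h.trans ENNReal.one_lt_top).ne, if_neg h.ne,
    if_neg fun h' => h'.1.not_gt h]

theorem dAlpha_eq_of_one_lt {α : ℝ≥0∞} (h : 1 < α) (ht : α < ⊤) {ρ σ : Matrix n n ℂ}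
    (hs : SuppLE ρ σ) :
    dAlpha α ρ σ = ((1 / (α.toReal - 1) : ℝ) : EReal) * elog (sandwichTr α.toReal ρ σ) := by
  rw [dAlpha, if_neg ht.ne, if_neg h.ne', if_neg fun h' => h'.2 hs]

theorem dAlpha_eq_top {α : ℝ≥0∞} (h : 1 < α) (ht : α < ⊤) {ρ σ : Matrix n n ℂ}
    (hs : ¬ SuppLE ρ σ) : dAlpha α ρ σ = ⊤ := by
  rw [dAlpha, if_neg ht.ne, if_neg h.ne', if_pos ⟨h, hs⟩]

/-- Applied with R(a) = tr τ^a and S(a) = tr τ_A^a, for the bound in `sandwichTr_oneTensor_le`. -/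
theorem hasDerivAt_upper_bound {R S : ℝ → ℝ} {R' S' : ℝ} (hS1 : S 1 = 1)
    (hR : HasDerivAt R R' 1) (hS : HasDerivAt S S' 1) :
    HasDerivAt (fun a => R a + (2 * a - 1) * (S (a / (2 * a - 1)) - 1)) (R' - S') 1 := by
  have h1 : HasDerivAt (fun a : ℝ => 2 * a - 1) 2 1 := by
    simpa using ((hasDerivAt_id' (1 : ℝ)).const_mul 2).sub_const 1
  have h2 : HasDerivAt (fun a : ℝ => a / (2 * a - 1)) (-1) 1 := by
    refine ((hasDerivAt_id' (1 : ℝ)).fun_div h1 (by norm_num)).congr_deriv ?_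
    norm_num
  have h3 := (HasDerivAt.comp_of_eq (1 : ℝ) hS h2 (by norm_num)).sub_const 1
  refine (hR.fun_add (h1.fun_mul h3)).congr_deriv ?_
  norm_num [hS1]
  ring

theorem hasDerivAt_lower_bound {R : ℝ → ℝ} {R' : ℝ} (hR1 : R 1 = 1) (hR : HasDerivAt R R' 1)
    (l m : ℝ) : HasDerivAt (fun a => (1 - a) * R a + a * (1 + (a - 1) * l) + (1 - a) * m)
      (l - m) 1 := by
  have h0 := hasDerivAt_id' (1 : ℝ)
  refine ((((h0.const_sub 1).fun_mul hR).fun_add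
    (h0.fun_mul (((h0.sub_const 1).mul_const l).const_add 1))).fun_add
      ((h0.const_sub 1).mul_const m)).congr_deriv ?_
  simp [hR1]
  ring

/-- The optimised sandwiched divergence relative to `1 ⊗ σ` is continuous at `α = 1`. -/
theorem tendsto_iInf_dAlpha {τ : Matrix (E × A) (E × A) ℂ} (hτ : IsState τ) :
    Filter.Tendsto (fun α : ℝ≥0∞ => ⨅ σ ∈ {σ : Matrix A A ℂ | IsState σ},
      dAlpha α τ (oneTensor E σ)) (𝓝[≠] 1) (𝓝 (-((condEntropy τ : ℝ) : EReal))) := by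
  have hl2 : Real.log 2 ≠ 0 := (Real.log_pos one_lt_two).ne'
  have hT := isState_ptraceE hτ
  have hS := posSemidef_oneTensor (E := E) hT.1
  have hsupp : SuppLE τ (oneTensor E (ptraceE τ)) :=
    (suppLE_oneTensor_iff hτ.1 hT.1).2 (suppLE_refl _)
  have hlog : rtr (τ * matLog (oneTensor E (ptraceE τ))) =
      rtr (ptraceE τ * matLog (ptraceE τ)) := by
    rw [matLog_oneTensor hT.1.1, rtr_mul_oneTensor]
  have hval : ∀ x : ℝ, x = Real.log 2 * rtr (τ * matLog τ) -
      Real.log 2 * rtr (ptraceE τ * matLog (ptraceE τ)) →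
      ((x / Real.log 2 : ℝ) : EReal) = -((condEntropy τ : ℝ) : EReal) := fun x hx => by
    rw [hx, ← EReal.coe_neg, condEntropy, vnEntropy, vnEntropy]
    congr 1
    field_simp
    ring
  have hR1 : rtr (matPow τ 1) = 1 := by rw [matPow_one hτ.1, hτ.rtr_eq_one]
  have hT1 : rtr (matPow (ptraceE τ) 1) = 1 := by rw [matPow_one hT.1, hT.rtr_eq_one]
  have hR := hasDerivAt_rtr_matPow hτ.1
  have hB := tendsto_mul_elog (by norm_num [hR1, hT1])
    (hasDerivAt_upper_bound hT1 hR (hasDerivAt_rtr_matPow hT.1))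
  have hC := tendsto_mul_elog (by norm_num)
    (hasDerivAt_lower_bound hR1 hR (Real.log 2 * rtr (τ * matLog τ))
      (Real.log 2 * rtr (ptraceE τ * matLog (ptraceE τ))))
  have hP := hasDerivAt_rtr_matPow_mul hτ.1 hS hsupp
  have hP1 : rtr (matPow τ 1 * matPow (oneTensor E (ptraceE τ)) ((1 - 1) / 1)) = 1 := by
    -- By 0 ^ 0 = 1 the zeroth power is the identity, not the support projection.
    have : matPow (oneTensor E (ptraceE τ)) 0 = 1 := by
      simp only [matPow, Real.rpow_zero]
      rw [cfc_const_eq hS.1, one_smul]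
    rw [sub_self, zero_div, this, mul_one, hR1]
  have hPt := tendsto_mul_elog hP1 hP
  obtain ⟨c, hc, hcS⟩ := exists_spectral_gap hS
  -- The exponent of the spectral gap c vanishes to second order at 1, so the gap factor does not
  -- affect the derivative.
  have hexp : HasDerivAt (fun a : ℝ => (1 - a) / a * (a - 1)) 0 1 := by
    refine (hasDerivAt_one_sub_div.fun_mul
      ((hasDerivAt_id' (1 : ℝ)).sub_const 1)).congr_deriv ?_
    norm_num
  have hG := tendsto_mul_elog (by simpa using hP1)
    ((hasDerivAt_rpow_comp hc (by norm_num) hexp).fun_mul hP)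
  rw [hval _ rfl] at hB hC
  rw [hval _ (by rw [hlog, mul_sub])] at hPt
  rw [hval _ (by rw [hlog]; norm_num; ring)] at hG
  have key : 𝓝[≠] (1 : ℝ≥0∞) = 𝓝[<] 1 ⊔ 𝓝[>] 1 := (nhdsLT_sup_nhdsGT 1).symm
  have hlt : Filter.Tendsto ENNReal.toReal (𝓝[<] 1) (𝓝[≠] 1) :=
    tendsto_toReal_nhdsNE_one.mono_left (by rw [key]; exact le_sup_left)
  have hgt : Filter.Tendsto ENNReal.toReal (𝓝[>] 1) (𝓝[≠] 1) :=
    tendsto_toReal_nhdsNE_one.mono_left (by rw [key]; exact le_sup_right)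
  rw [key]
  refine Filter.Tendsto.sup ?_ ?_
  · have hmem : ∀ᶠ α : ℝ≥0∞ in 𝓝[<] 1, 1 / 2 < α.toReal ∧ α < 1 ∧ α.toReal < 1 := by
      have h1 := (ENNReal.tendsto_toReal ENNReal.one_ne_top).mono_left
        (nhdsWithin_le_nhds (s := Set.Iio 1))
      rw [ENNReal.toReal_one] at h1
      filter_upwards [h1.eventually (lt_mem_nhds (by norm_num : (1 / 2 : ℝ) < 1)),
        self_mem_nhdsWithin] with α h2 h3
      exact ⟨h2, h3, by simpa using (ENNReal.toReal_lt_toReal (h3.trans ENNReal.one_lt_top).ne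
        ENNReal.one_ne_top).2 h3⟩
    -- Below 1 the prefactor is negative: the uniform upper bound on the trace bounds the infimum
    -- from below, and σ = τ_A bounds it from above.
    refine tendsto_of_tendsto_of_tendsto_of_le_of_le' (hB.comp hlt) (hPt.comp hlt) ?_ ?_
    · filter_upwards [hmem] with α ⟨h1, h2, h3⟩
      refine le_iInf₂ fun σ hσ => ?_
      rw [dAlpha_eq_of_lt_one h2]
      exact coe_mul_elog_anti (one_div_nonpos.2 (by linarith))
        (sandwichTr_oneTensor_le hτ hσ h1 h3)
    · filter_upwards [hmem] with α ⟨h1, h2, h3⟩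
      refine (iInf₂_le (ptraceE τ) hT).trans ?_
      rw [dAlpha_eq_of_lt_one h2]
      refine coe_mul_elog_anti (one_div_nonpos.2 (by linarith))
        (le_sandwichTr_of_lt_one hτ.1 hS (by linarith) h3 ?_)
      rw [matPow_oneTensor hT.1.1]
      exact oneTensor_le_one (hT.matPow_le_one (div_nonneg (by linarith) (by linarith)))
  · have hmem : ∀ᶠ α : ℝ≥0∞ in 𝓝[>] 1, 1 < α ∧ α < ⊤ ∧ 1 < α.toReal ∧ α.toReal ≤ 2 := by
      filter_upwards [self_mem_nhdsWithin, nhdsWithin_le_nhds (gt_mem_nhds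
        (ENNReal.one_lt_two))] with α h1 h2
      have ht : α < ⊤ := h2.trans ENNReal.ofNat_lt_top
      exact ⟨h1, ht, by simpa using (ENNReal.toReal_lt_toReal ENNReal.one_ne_top ht.ne).2 h1,
        by simpa using ENNReal.toReal_mono (by simp) h2.le⟩
    refine tendsto_of_tendsto_of_tendsto_of_le_of_le' (hC.comp hgt) (hG.comp hgt) ?_ ?_
    · filter_upwards [hmem] with α ⟨h1, h2, h3, h4⟩
      refine le_iInf₂ fun σ hσ => ?_
      by_cases hs : SuppLE τ (oneTensor E σ)
      · rw [dAlpha_eq_of_one_lt h1 h2 hs]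
        exact coe_mul_elog_mono (one_div_nonneg.2 (by linarith))
          (le_sandwichTr_oneTensor hτ hσ hs h3)
      · rw [dAlpha_eq_top h1 h2 hs]
        exact le_top
    · filter_upwards [hmem] with α ⟨h1, h2, h3, h4⟩
      refine (iInf₂_le (ptraceE τ) hT).trans ?_
      rw [dAlpha_eq_of_one_lt h1 h2 hsupp]
      exact coe_mul_elog_mono (one_div_nonneg.2 (by linarith))
        (sandwichTr_le_of_one_lt hτ.1 hS h3 h4 hc hcS)

variable {N : StarSubalgebra ℂ (Matrix A A ℂ)} {V : Matrix (E × A) A ℂ}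

theorem eventually_half_le : ∀ᶠ α : ℝ≥0∞ in 𝓝[≠] 1, 1 / 2 ≤ α :=
  nhdsWithin_le_nhds (le_mem_nhds (by simp))

theorem tendsto_dAlphaAlg (hV : IsStinespringIsometry (condExp N) V) {ρ : Matrix A A ℂ}
    (hρ : IsState ρ) : Filter.Tendsto (fun α : ℝ≥0∞ => dAlphaAlg α ρ N) (𝓝[≠] 1)
      (𝓝 (dAlphaAlg 1 ρ N)) := by
  rw [(dAlphaAlg_one hV hρ).1]
  refine (tendsto_iInf_dAlpha (isState_conj hV.1 hρ)).congr' ?_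
  filter_upwards [eventually_half_le] with α hα
  exact (dAlphaAlg_eq hV hρ hα).symm

theorem tendsto_hAlpha (hV : IsStinespringIsometry (condExp N) V) {ρ : Matrix A A ℂ}
    (hρ : IsState ρ) : Filter.Tendsto (fun α : ℝ≥0∞ => hAlpha α (V * ρ * Vᴴ)) (𝓝[≠] 1)
      (𝓝 ((condEntropy (V * ρ * Vᴴ) : ℝ) : EReal)) := by
  have h := tendsto_dAlphaAlg hV hρ
  rw [(dAlphaAlg_one hV hρ).1] at h
  have h2 := (continuous_neg.tendsto (-((condEntropy (V * ρ * Vᴴ) : ℝ) : EReal))).comp h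
  rw [neg_neg] at h2
  refine h2.congr' ?_
  filter_upwards [eventually_half_le] with α hα
  rw [Function.comp_apply, dAlphaAlg_eq_neg_hAlpha hV hρ hα, neg_neg]

end Limits

end SubalgEntropy

theorem mainTheorem2 {A E : Type*} [Fintype A] [DecidableEq A] [Fintype E] [DecidableEq E]
    (N : StarSubalgebra ℂ (Matrix A A ℂ)) (V : Matrix (E × A) A ℂ)
    (hV : SubalgEntropy.IsStinespringIsometry (SubalgEntropy.condExp N) V)
    (ρ : Matrix A A ℂ) (hρ : SubalgEntropy.IsState ρ) :
    (∀ ε : ℝ, 0 ≤ ε → ε < 1 →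
      (SubalgEntropy.dMaxAlgSmooth ε ρ N
          = ⨅ σ ∈ {σ : Matrix A A ℂ | SubalgEntropy.IsState σ},
              SubalgEntropy.dMaxSmooth ε (V * ρ * Vᴴ) (SubalgEntropy.oneTensor E σ)) ∧
      (SubalgEntropy.dMaxAlgSmooth ε ρ N = -SubalgEntropy.hMinSmooth ε (V * ρ * Vᴴ)) ∧
      (SubalgEntropy.dMinAlgSmooth ε ρ N
          = ⨅ σ ∈ {σ : Matrix A A ℂ | SubalgEntropy.IsState σ},
              SubalgEntropy.dMinSmooth ε (V * ρ * Vᴴ) (SubalgEntropy.oneTensor E σ)) ∧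
      (SubalgEntropy.dMinAlgSmooth ε ρ N = -SubalgEntropy.hMaxSmooth ε (V * ρ * Vᴴ))) ∧
    (∀ α : ℝ≥0∞, 1 / 2 ≤ α →
      (SubalgEntropy.dAlphaAlg α ρ N
          = ⨅ σ ∈ {σ : Matrix A A ℂ | SubalgEntropy.IsState σ},
              SubalgEntropy.dAlpha α (V * ρ * Vᴴ) (SubalgEntropy.oneTensor E σ)) ∧
      (SubalgEntropy.dAlphaAlg α ρ N = -SubalgEntropy.hAlpha α (V * ρ * Vᴴ))) ∧
    Filter.Tendsto (fun α : ℝ≥0∞ => SubalgEntropy.dAlphaAlg α ρ N) (𝓝[≠] 1)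
      (𝓝 (SubalgEntropy.dAlphaAlg 1 ρ N)) ∧
    Filter.Tendsto (fun α : ℝ≥0∞ => SubalgEntropy.hAlpha α (V * ρ * Vᴴ)) (𝓝[≠] 1)
      (𝓝 ((SubalgEntropy.condEntropy (V * ρ * Vᴴ) : ℝ) : EReal)) := by
  refine ⟨fun ε hε _ => ?_, fun α hα => ⟨SubalgEntropy.dAlphaAlg_eq hV hρ hα,
    SubalgEntropy.dAlphaAlg_eq_neg_hAlpha hV hρ hα⟩, SubalgEntropy.tendsto_dAlphaAlg hV hρ,
    SubalgEntropy.tendsto_hAlpha hV hρ⟩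
  have h1 := SubalgEntropy.dMinAlgSmooth_le hV hρ hε
  have h2 := SubalgEntropy.neg_hMaxSmooth_le ε (V * ρ * Vᴴ)
  have h3 := SubalgEntropy.iInf_dMinSmooth_le hV hρ hε
  -- The three inequalities form a cycle, so all three min-type quantities coincide.
  refine ⟨?_, SubalgEntropy.dMaxAlgSmooth_eq hV hρ hε, le_antisymm (h1.trans h2) h3,
    le_antisymm h1 (h2.trans h3)⟩
  rw [SubalgEntropy.iInf_dMaxSmooth_eq, SubalgEntropy.dMaxAlgSmooth_eq hV hρ hε]
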